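/- \textbf{Theorem (Elastic Net).} Fix $\rho\in(-1,1)$ and $\mu\ge 0$, and write $\eta=\rho/(1+\mu)$. For each $p\ge 1$ let $X\in\mathbb{R}^{n\times p}$ ($n=n_p$) be a design whose Gram matrix is $X'X=\mathrm{diag}(B,\ldots,B,B_0)$, where $B=\begin{pmatrix}1&\rho\\ \rho&1\end{pmatrix}$, $B_0=B$ if $p$ is even and $B_0=1$ if $p$ is odd. For $\vartheta\in(0,1)$ and $r>0$ let $y=X\beta+z$, where $z\sim N(0,I_n)$ is independent of $\beta$, and the $\beta_j$ are iid with $\mathbb{P}(\beta_j=\tau_p)=\epsilon_p=1-\mathbb{P}(\beta_j=0)$, $\epsilon_p=p^{-\vartheta}$, $\tau_p=\sqrt{2r\log p}$. Let $$\hat\beta^{\mathrm{EN}}=\operatorname{argmin}_b\bigl\{\|y-Xb\|^2/2+\lambda\|b\|_1+(\mu/2)\|b\|^2\bigr\},\qquad \lambda=\sqrt{2q\log p},\quad q>0$$ (for such a design and $\lambda\ge 0$ the minimizer exists and is unique), and let $H(\hat\beta,\beta)=\#\{j:\hat\beta_j\ne0,\beta_j=0\}+\#\{j:\hat\beta_j=0,\beta_j\neq0\}$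 be the Hamming error. Call a sequence $L_p$ a multi-$\log(p)$ term if $L_pp^{\epsilon}\to\infty$ and $L_pp^{-\epsilon}\to0$ for all $\epsilon>0$. There is a function $h(q;\vartheta,r)$, not depending on the choice of the designs $X$, such that $\mathbb{E}[H(\hat\beta^{\mathrm{EN}},\beta)]=L_p\,p^{1-h(q;\vartheta,r)}$ as $p\to\infty$, with a multi-$\log(p)$ term $L_p$, for all $q>0$, $\vartheta\in(0,1)$, $r>0$. For all $(\vartheta,r)$ there is an ideal $q$, that is, the maximum $h^*(\vartheta,r)=\max_{q>0}h(q;\vartheta,r)$ is attained. The phase curves $$L(\vartheta)=\inf\{r>0:h^*(\vartheta,r)>\vartheta\},\qquad U(\vartheta)=\inf\{r>0:h^*(\vartheta,r)>1\}\qquad(\inf\emptyset=\infty)$$ are, for every $\vartheta\in(0,1)$, given by $L(\vartheta)=\vartheta$ and $$U(\vartheta)=\begin{cases}\max\{h_1(\vartheta),h_2(\vartheta)\},&\rho\ge0,\text{ or }\rho<0\text{ and }\vartheta>1/2,\\ \max\{h_1(\vartheta),h_2(\vartheta),h_3(\vartheta),h_4(\vartheta)\},&\rho<0\text{ and }\vartheta\le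 1/2,\end{cases}$$ where $h_1(\vartheta)=(1+\sqrt{1-\vartheta})^2$, $$h_2(\vartheta)=\Bigl(\frac{1-|\eta|}{1-|\rho|}+\frac{\sqrt{1+\eta^2-2\rho\eta}}{1-|\rho|}\Bigr)^2(1-\vartheta),\qquad h_3(\vartheta)=\frac{1}{(1-|\rho|)^2}\Bigl(1+\frac{\sqrt{1+\eta^2-2\rho\eta}}{1+|\eta|}\sqrt{1-2\vartheta}\Bigr)^2,$$ $$h_4(\vartheta)=\frac{1+\eta^2-2\rho\eta}{(1-2|\rho|+\rho\eta)_+^2}\Bigl(\sqrt{1-\vartheta}+\frac{1-|\eta|}{1+|\eta|}\sqrt{1-2\vartheta}\Bigr)^2,$$ and $h_4(\vartheta)=\infty$ when $1-2|\rho|+\rho\eta\le0$. In particular, the Lasso estimator $\operatorname{argmin}_b\{\|y-Xb\|^2/2+\lambda\|b\|_1\}$, with ideally tuned $\lambda=\sqrt{2q\log p}$, has phase curves given by the same formulas with $\eta=\rho$ (the case $\mu=0$). -/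

import Mathlib

open MeasureTheory ProbabilityTheory Filter Topology

open scoped Matrix

noncomputable section

namespace RareWeak

/-- The block-diagonal Gram matrix `diag(B, …, B, B₀)` of size `p`, with `B = [[1, ρ], [ρ, 1]]`, and
`B₀ = B` for even `p`, `B₀ = 1` for odd `p`. With indices starting from `0` the blocks are the pairs
`{2k, 2k+1}`. -/
def blockGram (ρ : ℝ) (p : ℕ) : Matrix (Fin p) (Fin p) ℝ :=
  Matrix.of fun i j =>
    if i = j then 1 else if (i : ℕ) / 2 = (j : ℕ) / 2 then ρ else 0

/-- The signal strength `τ_p = √(2 r log p)`. -/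
def signalStrength (r : ℝ) (p : ℕ) : ℝ := Real.sqrt (2 * r * Real.log p)

/-- The sparsity `ε_p = p^{-ϑ}`. -/
def sparsity (ϑ : ℝ) (p : ℕ) : ℝ := (p : ℝ) ^ (-ϑ)

/-- The law of `β`: the coordinates are independent, equal to `τ_p` with probability `ε_p`
and to `0` with probability `1 - ε_p`. -/
def signalLaw (ϑ r : ℝ) (p : ℕ) : Measure (Fin p → ℝ) :=
  Measure.pi fun _ =>
    ENNReal.ofReal (sparsity ϑ p) • Measure.dirac (signalStrength r p) +
      ENNReal.ofReal (1 - sparsity ϑ p) • Measure.dirac 0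

/-- The law `N(0, I_n)` of the noise. -/
def noiseLaw (n : ℕ) : Measure (Fin n → ℝ) := Measure.pi fun _ => gaussianReal 0 1

/-- The Hamming error: the number of false positives plus the number of false negatives. -/
def hamming {p : ℕ} (bhat b : Fin p → ℝ) : ℝ :=
  (∑ j, if bhat j ≠ 0 ∧ b j = 0 then (1 : ℝ) else 0) +
    ∑ j, if bhat j = 0 ∧ b j ≠ 0 then (1 : ℝ) else 0

/-- An estimator with tuning parameter: `est X lam y` is the estimate of `β` based on the
design `X`, the tuning parameter `lam` and the response `y`. -/
abbrev TunedEstimator : Type :=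
  ∀ {n p : ℕ}, Matrix (Fin n) (Fin p) ℝ → ℝ → (Fin n → ℝ) → (Fin p → ℝ)

/-- The expected Hamming error, for `y = X β + z` with `β` and `z` independent, and
tuning parameter `lam`. -/
def expectedHamming (est : TunedEstimator) {n p : ℕ} (X : Matrix (Fin n) (Fin p) ℝ)
    (lam ϑ r : ℝ) : ℝ :=
  ∫ w : (Fin p → ℝ) × (Fin n → ℝ), hamming (est X lam (X *ᵥ w.1 + w.2)) w.1
    ∂((signalLaw ϑ r p).prod (noiseLaw n))

/-- The Elastic net objective `‖y - X b‖² / 2 + lam ‖b‖₁ + (μ / 2) ‖b‖²`. -/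
def elasticNetObjective {n p : ℕ} (μ : ℝ) (X : Matrix (Fin n) (Fin p) ℝ) (lam : ℝ)
    (y : Fin n → ℝ) (b : Fin p → ℝ) : ℝ :=
  (∑ i, (y i - (X *ᵥ b) i) ^ 2) / 2 + lam * ∑ j, |b j| + μ / 2 * ∑ j, b j ^ 2

/-- The Lasso objective `‖y - X b‖² / 2 + lam ‖b‖₁`. -/
def lassoObjective {n p : ℕ} (X : Matrix (Fin n) (Fin p) ℝ) (lam : ℝ)
    (y : Fin n → ℝ) (b : Fin p → ℝ) : ℝ :=
  (∑ i, (y i - (X *ᵥ b) i) ^ 2) / 2 + lam * ∑ j, |b j|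

/-- The Elastic net estimator: a minimizer of the Elastic net objective. -/
def elasticNet (μ : ℝ) : TunedEstimator := fun X lam y =>
  Classical.epsilon fun b => IsMinOn (elasticNetObjective μ X lam y) Set.univ b

/-- The Lasso estimator: a minimizer of the Lasso objective. -/
def lasso : TunedEstimator := fun X lam y =>
  Classical.epsilon fun b => IsMinOn (lassoObjective X lam y) Set.univ b

/-- The tuning parameter `λ = √(2 q log p)`. -/
def tuning (q : ℝ) (p : ℕ) : ℝ := Real.sqrt (2 * q * Real.log p)

/-- A multi-`log p` term: `L_p p^ε → ∞` and `L_p p^{-ε} → 0` for every `ε > 0`. -/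
def IsMultiLog (L : ℕ → ℝ) : Prop :=
  ∀ ε : ℝ, 0 < ε →
    Tendsto (fun p : ℕ => L p * (p : ℝ) ^ ε) atTop atTop ∧
      Tendsto (fun p : ℕ => L p * (p : ℝ) ^ (-ε)) atTop (𝓝 0)

/-- `E_p = L_p p^a` with a multi-`log p` term `L_p`. -/
def HasPolyRate (E : ℕ → ℝ) (a : ℝ) : Prop :=
  ∃ L : ℕ → ℝ, IsMultiLog L ∧ ∀ᶠ p : ℕ in atTop, E p = L p * (p : ℝ) ^ a

/-- `h q ϑ r` is the Hamming exponent of `est` tuned with `λ = √(2 q log p)`: for all designs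
with block-diagonal Gram matrices, `E[H] = L_p p^{1 - h q ϑ r}`. -/
def IsHammingExponent (ρ : ℝ) (est : TunedEstimator) (h : ℝ → ℝ → ℝ → ℝ) : Prop :=
  ∀ (n : ℕ → ℕ) (X : ∀ p : ℕ, Matrix (Fin (n p)) (Fin p) ℝ),
    (∀ p, (X p)ᵀ * X p = blockGram ρ p) →
    ∀ q ϑ r : ℝ, 0 < q → 0 < ϑ → ϑ < 1 → 0 < r →
      HasPolyRate (fun p => expectedHamming est (X p) (tuning q p) ϑ r) (1 - h q ϑ r)

/-- `hstar ϑ r` is the Hamming exponent for an ideal choice of the constant `q > 0`, one that makes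
the exponent `1 - h q ϑ r` of the expected Hamming error minimal. -/
def IsIdealExponent (h : ℝ → ℝ → ℝ → ℝ) (hstar : ℝ → ℝ → ℝ) : Prop :=
  ∀ ϑ r : ℝ, 0 < ϑ → ϑ < 1 → 0 < r →
    IsGreatest ((fun q => h q ϑ r) '' Set.Ioi 0) (hstar ϑ r)

/-- The upper phase curve `inf {r > 0 : h(ϑ, r) > 1}`, equal to `∞` if there is no such `r`. -/
def upperPhaseCurve (hstar : ℝ → ℝ → ℝ) (ϑ : ℝ) : EReal :=
  sInf ((fun r : ℝ => (r : EReal)) '' {r : ℝ | 0 < r ∧ 1 < hstar ϑ r})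

/-- The lower phase curve `inf {r > 0 : h(ϑ, r) > ϑ}`, equal to `∞` if there is no such `r`. -/
def lowerPhaseCurve (hstar : ℝ → ℝ → ℝ) (ϑ : ℝ) : EReal :=
  sInf ((fun r : ℝ => (r : EReal)) '' {r : ℝ | 0 < r ∧ ϑ < hstar ϑ r})

/-- The ideally tuned estimator `est` has a Hamming exponent, and its lower and upper phase curves
are `L` and `U`. -/
def HasPhaseCurves (ρ : ℝ) (est : TunedEstimator) (L U : ℝ → EReal) : Prop :=
  ∃ (h : ℝ → ℝ → ℝ → ℝ) (hstar : ℝ → ℝ → ℝ),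
    IsHammingExponent ρ est h ∧ IsIdealExponent h hstar ∧
      ∀ ϑ : ℝ, 0 < ϑ → ϑ < 1 →
        lowerPhaseCurve hstar ϑ = L ϑ ∧ upperPhaseCurve hstar ϑ = U ϑ

def h₁ (ϑ : ℝ) : ℝ := (1 + Real.sqrt (1 - ϑ)) ^ 2

def h₂ (ρ η ϑ : ℝ) : ℝ :=
  ((1 - |η|) / (1 - |ρ|) + Real.sqrt (1 + η ^ 2 - 2 * ρ * η) / (1 - |ρ|)) ^ 2 * (1 - ϑ)

def h₃ (ρ η ϑ : ℝ) : ℝ :=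
  1 / (1 - |ρ|) ^ 2 *
    (1 + Real.sqrt (1 + η ^ 2 - 2 * ρ * η) / (1 + |η|) * Real.sqrt (1 - 2 * ϑ)) ^ 2

/-- The curve with denominator `(1 - 2|ρ| + ρη)₊²`, equal to `∞` when this denominator is zero. -/
def h₄ (ρ η ϑ : ℝ) : EReal :=
  if 0 < 1 - 2 * |ρ| + ρ * η then
    (((1 + η ^ 2 - 2 * ρ * η) / (1 - 2 * |ρ| + ρ * η) ^ 2 *
      (Real.sqrt (1 - ϑ) + (1 - |η|) / (1 + |η|) * Real.sqrt (1 - 2 * ϑ)) ^ 2 : ℝ) : EReal)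
  else ⊤

/-- The claimed upper phase curve. The curves `h₃` and `h₄`, which contain `√(1 - 2ϑ)`, take part
in the maximum where they are defined, that is, for `ϑ ≤ 1/2`. -/
def upperCurveFormula (ρ η ϑ : ℝ) : EReal :=
  if ρ < 0 ∧ ϑ ≤ 1 / 2 then
    max (max (h₁ ϑ : EReal) (h₂ ρ η ϑ : EReal)) (max (h₃ ρ η ϑ : EReal) (h₄ ρ η ϑ))
  else
    max (h₁ ϑ : EReal) (h₂ ρ η ϑ : EReal)

end RareWeak

end

/-! Blocks interact only through the Gram matrix. Optimality in one coordinate at a time makes `(1 +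
μ) b_j` the soft thresholding of `x_j - η (1 + μ) b_k`, where `x = X'y` and `k` is the partner of
`j`. Since `|η| < 1`, the two coupled equations of a block form a contraction, so the minimizer is
unique and `j` is selected exactly when `|x_j - η S(x_k)| > λ`, with `S` the soft thresholding at
`λ` (`elasticNet_ne_zero_iff`).

After whitening, `(x_j, x_k)` is a standard Gaussian vector of the plane shifted by a mean that
depends on `(β_j, β_k)`, and the selection region scales linearly with `λ`. Both `λ` and the signal
are multiples of `t = √(2 log p)`. A Gaussian vector reaches a set at distance `t d` with
probability about `exp(-t² d² / 2) = p^{-d²}`; `upperRate_plane` and `lowerRate_plane` make this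
precise up to factors `p^ε`. Weighting by the signal configuration, which costs `p^{-ϑ}` for each
signal, the error probability of an index in a pair has the exponent `blockExponent`, a minimum of
four terms. Summing over the indices gives the Hamming exponent; a last unpaired index is
negligible. Continuity in `q` and the bounds `h ≤ q` and `h ≤ ϑ` for `q ≥ r` give an ideal `q`.

For the phase curves put `s = √q`, `R = √r`, `κ² = 1 + η² - 2ρη`. The four squared distances need
not be computed everywhere. Lower bounds come from half-planes, on which `x₁` or `x₁ - η x₂` is
bounded, and upper bounds from explicit points; they agree in the range where they decide whether
the exponent exceeds `1`. The remaining conditions are linear in `s`: two lower bounds, `1` (nulls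
next to nulls) and one from nulls next to a signal, and two upper bounds, one from isolated signals
and, if `ρ < 0` and `ϑ ≤ 1/2`, one from pairs of signals that partly cancel. An admissible `s`
exists exactly when each lower bound is below each upper bound, and these comparisons are the curves
`h₁`, `h₂`, `h₃`, `h₄` (`exists_one_lt_blockExponent_iff`, `exists_level_iff`). -/

noncomputable section
namespace RareWeak

/-! ### Soft thresholding -/

/-- Soft thresholding of `x` at level `s`. -/
def softThreshold (s x : ℝ) : ℝ := max (x - s) 0 - max (-x - s) 0

lemma continuous_softThreshold (s : ℝ) : Continuous (softThreshold s) := by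
  unfold softThreshold; fun_prop

lemma abs_sub_softThreshold_le {s : ℝ} (hs : 0 ≤ s) (x : ℝ) : |x - softThreshold s x| ≤ s := by
  unfold softThreshold
  rw [abs_le]
  rcases max_cases (x - s) 0 with h | h <;> rcases max_cases (-x - s) 0 with h' | h' <;>
    constructor <;> linarith

/-- Together with `abs_sub_softThreshold_le` this says that `x - softThreshold s x` is a subgradient
of `s |·|` at `softThreshold s x`. -/
lemma sub_softThreshold_mul {s : ℝ} (hs : 0 ≤ s) (x : ℝ) :
    (x - softThreshold s x) * softThreshold s x = s * |softThreshold s x| := by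
  unfold softThreshold
  rcases max_cases (x - s) 0 with h | h <;> rcases max_cases (-x - s) 0 with h' | h' <;>
    rw [h.1, h'.1]
  · have h1 : x = 0 := by linarith
    have h2 : s = 0 := by linarith
    simp [h1, h2]
  · rw [sub_zero, abs_of_nonneg h.2]; ring
  · rw [zero_sub, abs_neg, abs_of_nonneg h'.2]; ring
  · simp

lemma softThreshold_eq_zero_iff {s x : ℝ} (hs : 0 ≤ s) : softThreshold s x = 0 ↔ |x| ≤ s := by
  constructor
  · intro h
    simpa [h] using abs_sub_softThreshold_le hs x
  · intro h
    rw [abs_le] at h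
    unfold softThreshold
    rw [max_eq_right (by linarith), max_eq_right (by linarith), sub_zero]

lemma softThreshold_of_le {s x : ℝ} (hs : 0 ≤ s) (h : s ≤ x) : softThreshold s x = x - s := by
  unfold softThreshold
  rw [max_eq_left (by linarith), max_eq_right (by linarith), sub_zero]

lemma softThreshold_neg (s x : ℝ) : softThreshold s (-x) = -softThreshold s x := by
  unfold softThreshold
  rw [neg_neg]; ring

lemma softThreshold_mul {c : ℝ} (hc : 0 ≤ c) (s x : ℝ) :
    softThreshold (c * s) (c * x) = c * softThreshold s x := by
  unfold softThreshold
  rw [mul_sub, mul_max_of_nonneg _ _ hc, mul_max_of_nonneg _ _ hc, mul_zero]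
  ring_nf

lemma abs_softThreshold_sub_le {s : ℝ} (hs : 0 ≤ s) (x y : ℝ) :
    |softThreshold s x - softThreshold s y| ≤ |x - y| := by
  wlog hxy : y ≤ x generalizing x y
  · rw [abs_sub_comm, abs_sub_comm x y]
    exact this y x (le_of_not_ge hxy)
  unfold softThreshold
  rw [abs_of_nonneg (sub_nonneg.2 hxy), abs_le]
  rcases max_cases (x - s) 0 with h | h <;> rcases max_cases (-x - s) 0 with h' | h' <;>
  rcases max_cases (y - s) 0 with k | k <;> rcases max_cases (-y - s) 0 with k' | k' <;>
    constructor <;> linarith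

/-- A multiple of the soft thresholding of `x` is below that of `x`, shifted by the level. -/
lemma mul_softThreshold_le (s η x : ℝ) :
    η * softThreshold s x ≤ max 0 (η * x - |η| * s) := by
  wlog hη : 0 ≤ η generalizing η x
  · have := this (-η) (-x) (by linarith)
    rwa [softThreshold_neg, neg_mul_neg, neg_mul_neg, abs_neg] at this
  rw [abs_of_nonneg hη, ← mul_sub, ← mul_zero η, ← mul_max_of_nonneg _ _ hη]
  refine mul_le_mul_of_nonneg_left ?_ hη
  unfold softThreshold
  rw [max_comm]
  linarith [le_max_right (-x - s) 0]

/-- The minimizer of a penalized quadratic function of one variable. -/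
lemma mul_eq_softThreshold_of_isMin {c s x t : ℝ} (hc : 0 < c) (hs : 0 ≤ s)
    (h : ∀ t', c / 2 * t ^ 2 - x * t + s * |t| ≤ c / 2 * t' ^ 2 - x * t' + s * |t'|) :
    c * t = softThreshold s x := by
  set S := softThreshold s x with hS
  have h1 := h (S / c)
  have h2 : (x - S) * (S / c) = s * |S / c| := by
    rw [abs_div, abs_of_pos hc, ← mul_div_assoc, ← mul_div_assoc, sub_softThreshold_mul hs]
  have h3 : (x - S) * t ≤ s * |t| := by
    calc (x - S) * t ≤ |(x - S) * t| := le_abs_self _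
      _ = |x - S| * |t| := abs_mul _ _
      _ ≤ s * |t| := by gcongr; exact abs_sub_softThreshold_le hs x
  have h4 : S = c * (S / c) := by field_simp
  set u := S / c
  -- Strong convexity: the subgradient relations `h2` and `h3` make the objective at `t` exceed that
  -- at `u` by at least the left side, while `t` is minimal.
  have h5 : c / 2 * (t - u) ^ 2 ≤ 0 := by
    rw [h4] at h2 h3
    nlinarith
  have h6 : (t - u) ^ 2 ≤ 0 := by
    by_contra hne
    push Not at hne
    have := mul_pos (half_pos hc) hne
    linarith
  have h7 : t - u = 0 := by
    have := sq_nonneg (t - u)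
    exact pow_eq_zero_iff (two_ne_zero) |>.1 (le_antisymm h6 this)
  rw [h4, sub_eq_zero.1 h7]

/-- The coupled soft thresholding equations of a pair have at most one solution. -/
lemma eq_of_softThreshold_pair {η s x y a b a' b' : ℝ} (hη : |η| < 1) (hs : 0 ≤ s)
    (ha : a = softThreshold s (x - η * b)) (hb : b = softThreshold s (y - η * a))
    (ha' : a' = softThreshold s (x - η * b')) (hb' : b' = softThreshold s (y - η * a')) :
    a = a' := by
  have h1 : |a - a'| ≤ |η| * |b - b'| := by
    have h := abs_softThreshold_sub_le hs (x - η * b) (x - η * b')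
    rw [← ha, ← ha', show x - η * b - (x - η * b') = -(η * (b - b')) by ring, abs_neg,
      abs_mul] at h
    exact h
  have h2 : |b - b'| ≤ |η| * |a - a'| := by
    have h := abs_softThreshold_sub_le hs (y - η * a) (y - η * a')
    rw [← hb, ← hb', show y - η * a - (y - η * a') = -(η * (a - a')) by ring, abs_neg,
      abs_mul] at h
    exact h
  -- Going once around the block contracts differences by `η² < 1`.
  have h3 : |a - a'| ≤ |η| * |η| * |a - a'| :=
    h1.trans ((mul_le_mul_of_nonneg_left h2 (abs_nonneg _)).trans_eq (by ring))
  have h4 : |η| * |η| < 1 := mul_lt_one_of_nonneg_of_lt_one_left (abs_nonneg _) hη hη.le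
  have h5 : |a - a'| = 0 := by
    by_contra hne
    have hpos := lt_of_le_of_ne (abs_nonneg _) (Ne.symm hne)
    have := mul_lt_mul_of_pos_right h4 hpos
    linarith
  exact sub_eq_zero.1 (abs_eq_zero.1 h5)

/-! ### The block structure of the Gram matrix -/

/-- The other indices in the block of `j`: one index, or none for the last index when `p` is odd. -/
def partners {p : ℕ} (j : Fin p) : Finset (Fin p) :=
  {k | k ≠ j ∧ (k : ℕ) / 2 = (j : ℕ) / 2}

lemma mem_partners {p : ℕ} {j k : Fin p} :
    k ∈ partners j ↔ k ≠ j ∧ (k : ℕ) / 2 = (j : ℕ) / 2 := by simp [partners]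

lemma mem_partners_comm {p : ℕ} {j k : Fin p} : k ∈ partners j ↔ j ∈ partners k := by
  rw [mem_partners, mem_partners]
  exact ⟨fun h => ⟨h.1.symm, h.2.symm⟩, fun h => ⟨h.1.symm, h.2.symm⟩⟩

lemma card_partners_le_one {p : ℕ} (j : Fin p) : (partners j).card ≤ 1 := by
  rw [Finset.card_le_one]
  intro a ha b hb
  rw [mem_partners] at ha hb
  have h1 := Fin.val_ne_of_ne ha.1
  have h2 := Fin.val_ne_of_ne hb.1
  apply Fin.ext
  omega

lemma partners_eq_singleton {p : ℕ} {j k : Fin p} (h : k ∈ partners j) : partners j = {k} :=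
  Finset.eq_singleton_iff_unique_mem.2
    ⟨h, fun x hx => Finset.card_le_one.1 (card_partners_le_one j) x hx k h⟩

lemma partners_eq_empty_or {p : ℕ} (j : Fin p) :
    partners j = ∅ ∨ ∃ k, k ≠ j ∧ partners j = {k} ∧ partners k = {j} := by
  rcases (partners j).eq_empty_or_nonempty with h | ⟨k, hk⟩
  · exact Or.inl h
  · exact Or.inr ⟨k, (mem_partners.1 hk).1, partners_eq_singleton hk,
      partners_eq_singleton (mem_partners_comm.1 hk)⟩

lemma exists_partner {p : ℕ} (j : Fin p) (h : (j : ℕ) + 1 < p) : ∃ k, k ∈ partners j := by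
  rcases Nat.even_or_odd (j : ℕ) with he | ho
  · refine ⟨⟨j + 1, h⟩, mem_partners.2 ⟨fun h => ?_, ?_⟩⟩
    · have := congrArg Fin.val h
      simp at this
    · obtain ⟨m, hm⟩ := he
      simp only
      omega
  · obtain ⟨m, hm⟩ := ho
    refine ⟨⟨j - 1, by omega⟩, mem_partners.2 ⟨fun h => ?_, ?_⟩⟩
    · have := congrArg Fin.val h
      simp only at this
      omega
    · simp only
      omega

lemma blockGram_mulVec (ρ : ℝ) {p : ℕ} (b : Fin p → ℝ) (j : Fin p) :
    (blockGram ρ p *ᵥ b) j = b j + ρ * ∑ k ∈ partners j, b k := by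
  have h : ∀ k, blockGram ρ p j k * b k =
      (if j = k then b k else 0) + (if k ≠ j ∧ (k : ℕ) / 2 = (j : ℕ) / 2 then ρ * b k else 0) := by
    intro k
    by_cases h1 : j = k
    · simp [blockGram, h1]
    · have h2 : k ≠ j := fun h => h1 h.symm
      by_cases h3 : (k : ℕ) / 2 = (j : ℕ) / 2
      · simp [blockGram, h1, h2, h3]
      · have h4 : ¬ (j : ℕ) / 2 = (k : ℕ) / 2 := fun h => h3 h.symm
        simp [blockGram, h1, h3, h4]
  rw [Matrix.mulVec, dotProduct, Finset.sum_congr rfl fun k _ => h k, Finset.sum_add_distrib,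
    Finset.sum_ite_eq, ← Finset.sum_filter, Finset.mul_sum]
  simp [partners]

/-- The eigenvalues of the Gram matrix are at least `1 - |ρ|`: cross terms are bounded by `2|uv| ≤
u² + v²`, and each index is the partner of at most one other. It provides coercivity. -/
lemma le_dotProduct_blockGram_mulVec (ρ : ℝ) {p : ℕ} (b : Fin p → ℝ) :
    (1 - |ρ|) * ∑ j, b j ^ 2 ≤ b ⬝ᵥ (blockGram ρ p *ᵥ b) := by
  have h1 : ∀ j : Fin p, (∑ k ∈ partners j, b k) ^ 2 = ∑ k ∈ partners j, b k ^ 2 := by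
    intro j
    rcases partners_eq_empty_or j with h | ⟨k, -, h, -⟩ <;> simp [h]
  have h2 : ∑ j : Fin p, ∑ k ∈ partners j, b k ^ 2 ≤ ∑ k, b k ^ 2 := by
    rw [Finset.sum_comm' (t' := Finset.univ) (s' := fun k => partners k)
      (fun x y => by simp [mem_partners_comm])]
    refine Finset.sum_le_sum fun k _ => ?_
    rw [Finset.sum_const, nsmul_eq_mul]
    have : ((partners k).card : ℝ) ≤ 1 := by exact_mod_cast card_partners_le_one k
    nlinarith [sq_nonneg (b k)]
  have h3 : ∀ j : Fin p, b j ^ 2 - |ρ| * ((b j ^ 2 + ∑ k ∈ partners j, b k ^ 2) / 2) ≤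
      b j * (blockGram ρ p *ᵥ b) j := by
    intro j
    rw [blockGram_mulVec, ← h1]
    set N := ∑ k ∈ partners j, b k
    have h4 : |b j * N| ≤ (b j ^ 2 + N ^ 2) / 2 := by
      rw [abs_le]
      constructor <;> nlinarith [sq_nonneg (b j + N), sq_nonneg (b j - N)]
    have h5 : -(|ρ| * |b j * N|) ≤ ρ * (b j * N) := by
      rw [← abs_mul]; exact neg_abs_le _
    nlinarith [mul_le_mul_of_nonneg_left h4 (abs_nonneg ρ)]
  calc (1 - |ρ|) * ∑ j, b j ^ 2
      ≤ ∑ j, b j ^ 2 - |ρ| * ((∑ j, b j ^ 2 + ∑ j : Fin p, ∑ k ∈ partners j, b k ^ 2) / 2) := by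
        nlinarith [mul_le_mul_of_nonneg_left h2 (abs_nonneg ρ)]
    _ = ∑ j : Fin p, (b j ^ 2 - |ρ| * ((b j ^ 2 + ∑ k ∈ partners j, b k ^ 2) / 2)) := by
        rw [Finset.sum_sub_distrib, ← Finset.mul_sum, ← Finset.sum_div, Finset.sum_add_distrib]
    _ ≤ _ := Finset.sum_le_sum fun j _ => h3 j

/-! ### Minimizers of the Elastic net objective -/

lemma lassoObjective_eq {n p : ℕ} (X : Matrix (Fin n) (Fin p) ℝ) (lam : ℝ) (y : Fin n → ℝ) :
    lassoObjective X lam y = elasticNetObjective 0 X lam y := by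
  funext b
  simp [lassoObjective, elasticNetObjective]

/-- Along a coordinate line the objective is a quadratic plus a multiple of `|t|`, which reduces
optimality to the one-variable problem. -/
lemma elasticNetObjective_add_single {n p : ℕ} (μ : ℝ) (X : Matrix (Fin n) (Fin p) ℝ) (lam : ℝ)
    (y : Fin n → ℝ) (b : Fin p → ℝ) (j : Fin p) (t : ℝ) :
    elasticNetObjective μ X lam y (b + Pi.single j (t - b j)) = elasticNetObjective μ X lam y b
      - (t - b j) * ((Xᵀ *ᵥ y) j - ((Xᵀ * X) *ᵥ b) j) + (t - b j) ^ 2 * (Xᵀ * X) j j / 2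
      + lam * (|t| - |b j|) + μ / 2 * (t ^ 2 - b j ^ 2) := by
  set δ := t - b j with hδ
  have h1 : ∑ i, (y i - (X *ᵥ (b + Pi.single j δ)) i) ^ 2 = ∑ i, (y i - (X *ᵥ b) i) ^ 2
      - 2 * δ * ((Xᵀ *ᵥ y) j - ((Xᵀ * X) *ᵥ b) j) + δ ^ 2 * (Xᵀ * X) j j := by
    have h2 : (Xᵀ *ᵥ y) j - ((Xᵀ * X) *ᵥ b) j = ∑ i, X i j * (y i - (X *ᵥ b) i) := by
      rw [← Matrix.mulVec_mulVec, ← Pi.sub_apply, ← Matrix.mulVec_sub]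
      rfl
    rw [h2, Matrix.mul_apply, Finset.mul_sum, Finset.mul_sum, ← Finset.sum_sub_distrib,
      ← Finset.sum_add_distrib]
    refine Finset.sum_congr rfl fun i _ => ?_
    rw [Matrix.mulVec_add, Pi.add_apply, Matrix.mulVec_single, Matrix.transpose_apply]
    simp only [Pi.smul_apply, MulOpposite.smul_eq_mul_unop, MulOpposite.unop_op, Matrix.col_apply]
    ring
  have h3 : ∀ f : ℝ → ℝ, ∑ k, f ((b + Pi.single j δ : Fin p → ℝ) k) =
      ∑ k, f (b k) + (f t - f (b j)) := by
    intro f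
    rw [← Finset.add_sum_erase _ _ (Finset.mem_univ j),
      ← Finset.add_sum_erase _ (fun k => f (b k)) (Finset.mem_univ j)]
    have : ∑ k ∈ Finset.univ.erase j, f ((b + Pi.single j δ : Fin p → ℝ) k) =
        ∑ k ∈ Finset.univ.erase j, f (b k) := by
      refine Finset.sum_congr rfl fun k hk => ?_
      simp [Pi.single_eq_of_ne (Finset.ne_of_mem_erase hk)]
    rw [this]
    simp [hδ]
    ring
  unfold elasticNetObjective
  rw [h1, h3 (fun x => |x|), h3 (fun x => x ^ 2)]
  ring

section Minimizer

variable {n p : ℕ} {ρ μ : ℝ} {X : Matrix (Fin n) (Fin p) ℝ}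

lemma exists_isMinOn_elasticNetObjective (hρ : |ρ| < 1) (hμ : 0 ≤ μ)
    (hX : Xᵀ * X = blockGram ρ p) {lam : ℝ} (hlam : 0 ≤ lam) (y : Fin n → ℝ) :
    ∃ b, IsMinOn (elasticNetObjective μ X lam y) Set.univ b := by
  have hcont : Continuous (elasticNetObjective μ X lam y) := by
    unfold elasticNetObjective Matrix.mulVec dotProduct
    fun_prop
  have hle : ∀ b, (1 - |ρ|) / 4 * ‖b‖ ^ 2 + -(∑ i, y i ^ 2 / 2) ≤
      elasticNetObjective μ X lam y b := by
    intro b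
    have h1 : (1 - |ρ|) * ∑ j, b j ^ 2 ≤ ∑ i, (X *ᵥ b) i ^ 2 := by
      have h := le_dotProduct_blockGram_mulVec ρ b
      rw [← hX, ← Matrix.mulVec_mulVec, Matrix.dotProduct_mulVec, Matrix.vecMul_transpose] at h
      simpa [dotProduct, sq] using h
    have h2 : ‖b‖ ^ 2 ≤ ∑ j, b j ^ 2 := by
      rw [← Real.le_sqrt (norm_nonneg _) (Finset.sum_nonneg fun j _ => sq_nonneg _),
        pi_norm_le_iff_of_nonneg (Real.sqrt_nonneg _)]
      intro j
      refine Real.le_sqrt_of_sq_le ?_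
      rw [Real.norm_eq_abs, sq_abs]
      exact Finset.single_le_sum (f := fun j => b j ^ 2) (fun j _ => sq_nonneg _)
        (Finset.mem_univ j)
    -- Termwise, the difference of the two sides is the square `(y - v/2)²` with `v = (X b)_i`.
    have h3 : ∑ i, (X *ᵥ b) i ^ 2 / 4 - ∑ i, y i ^ 2 / 2 ≤ (∑ i, (y i - (X *ᵥ b) i) ^ 2) / 2 := by
      rw [← Finset.sum_sub_distrib, Finset.sum_div]
      refine Finset.sum_le_sum fun i _ => ?_
      nlinarith [sq_nonneg (y i - (X *ᵥ b) i / 2)]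
    have h4 : 0 ≤ lam * ∑ j, |b j| :=
      mul_nonneg hlam (Finset.sum_nonneg fun j _ => abs_nonneg _)
    have h5 : 0 ≤ μ / 2 * ∑ j, b j ^ 2 :=
      mul_nonneg (by positivity) (Finset.sum_nonneg fun j _ => sq_nonneg _)
    have h6 := mul_le_mul_of_nonneg_left h2 (sub_nonneg.2 hρ.le)
    rw [← Finset.sum_div] at h3
    unfold elasticNetObjective
    linarith
  have htend : Tendsto (elasticNetObjective μ X lam y) (cocompact _) atTop := by
    refine tendsto_atTop_mono hle (tendsto_atTop_add_const_right _ _ ?_)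
    exact ((tendsto_pow_atTop two_ne_zero).comp tendsto_norm_cocompact_atTop).const_mul_atTop
      (by linarith)
  obtain ⟨b, hb⟩ := hcont.exists_forall_le htend
  exact ⟨b, fun b' _ => hb b'⟩

/-- Optimality in the `j`-th coordinate alone. In the variables `(1 + μ) b` the ridge penalty only
changes the coupling from `ρ` to `ρ / (1 + μ)`. -/
lemma IsMinOn.mul_eq_softThreshold (hμ : 0 ≤ μ) (hX : Xᵀ * X = blockGram ρ p) {lam : ℝ}
    (hlam : 0 ≤ lam) {y : Fin n → ℝ} {b : Fin p → ℝ}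
    (hb : IsMinOn (elasticNetObjective μ X lam y) Set.univ b) (j : Fin p) :
    (1 + μ) * b j = softThreshold lam
      ((Xᵀ *ᵥ y) j - ρ / (1 + μ) * ∑ k ∈ partners j, (1 + μ) * b k) := by
  rw [← Finset.mul_sum, ← mul_assoc, div_mul_cancel₀ _ (by positivity)]
  refine mul_eq_softThreshold_of_isMin (by positivity) hlam fun t => ?_
  have h1 := hb (Set.mem_univ (b + Pi.single j (t - b j)))
  simp only [Set.mem_ofPred_eq] at h1
  rw [elasticNetObjective_add_single, hX, blockGram_mulVec] at h1
  have h2 : blockGram ρ p j j = 1 := by simp [blockGram]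
  rw [h2] at h1
  nlinarith

lemma abs_div_one_add_lt_one (hρ : |ρ| < 1) (hμ : 0 ≤ μ) : |ρ / (1 + μ)| < 1 := by
  rw [abs_div, abs_of_pos (by positivity : 0 < 1 + μ), div_lt_one (by positivity)]
  linarith

/-- A coordinate of a minimizer is nonzero exactly when the response exceeds the level after the
soft thresholded contribution of the other index of its block is removed. -/
lemma IsMinOn.ne_zero_iff (hρ : |ρ| < 1) (hμ : 0 ≤ μ) (hX : Xᵀ * X = blockGram ρ p) {lam : ℝ}
    (hlam : 0 ≤ lam) {y : Fin n → ℝ} {b : Fin p → ℝ}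
    (hb : IsMinOn (elasticNetObjective μ X lam y) Set.univ b) (j : Fin p) :
    b j ≠ 0 ↔ lam < |(Xᵀ *ᵥ y) j -
      ρ / (1 + μ) * ∑ k ∈ partners j, softThreshold lam ((Xᵀ *ᵥ y) k)| := by
  have hj := IsMinOn.mul_eq_softThreshold hμ hX hlam hb j
  have hpos : (1 + μ) ≠ 0 := by positivity
  rw [← not_le, not_iff_not, ← softThreshold_eq_zero_iff hlam]
  rcases partners_eq_empty_or j with h | ⟨k, -, h, h'⟩
  · simp only [h, Finset.sum_empty, mul_zero, sub_zero] at hj ⊢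
    rw [← hj]
    simp [hpos]
  · have hk := IsMinOn.mul_eq_softThreshold hμ hX hlam hb k
    simp only [h, h', Finset.sum_singleton] at hj hk ⊢
    constructor
    · intro h0
      rw [h0, mul_zero, mul_zero, sub_zero] at hk
      rw [← hk, ← hj, h0, mul_zero]
    · intro h0
      -- The pair consisting of `0` and the soft thresholding of the partner's response solves the
      -- coupled equations, hence is the solution.
      have := eq_of_softThreshold_pair (abs_div_one_add_lt_one hρ hμ) hlam hj hk h0.symm
        (by rw [mul_zero, sub_zero])
      simpa [hpos] using this

lemma existsUnique_isMinOn_elasticNetObjective (hρ : |ρ| < 1) (hμ : 0 ≤ μ)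
    (hX : Xᵀ * X = blockGram ρ p) {lam : ℝ} (hlam : 0 ≤ lam) (y : Fin n → ℝ) :
    ∃! b, IsMinOn (elasticNetObjective μ X lam y) Set.univ b := by
  obtain ⟨b, hb⟩ := exists_isMinOn_elasticNetObjective hρ hμ hX hlam y
  refine ⟨b, hb, fun b' hb' => funext fun j => ?_⟩
  have hpos : (1 + μ) ≠ 0 := by positivity
  have hj := IsMinOn.mul_eq_softThreshold hμ hX hlam hb j
  have hj' := IsMinOn.mul_eq_softThreshold hμ hX hlam hb' j
  refine mul_left_cancel₀ hpos ?_
  rcases partners_eq_empty_or j with h | ⟨k, -, h, h'⟩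
  · rw [hj, hj', h, Finset.sum_empty, Finset.sum_empty]
  · have hk := IsMinOn.mul_eq_softThreshold hμ hX hlam hb k
    have hk' := IsMinOn.mul_eq_softThreshold hμ hX hlam hb' k
    simp only [h, h', Finset.sum_singleton] at hj hk hj' hk'
    exact eq_of_softThreshold_pair (abs_div_one_add_lt_one hρ hμ) hlam hj' hk' hj hk

lemma elasticNet_ne_zero_iff (hρ : |ρ| < 1) (hμ : 0 ≤ μ) (hX : Xᵀ * X = blockGram ρ p) {lam : ℝ}
    (hlam : 0 ≤ lam) (y : Fin n → ℝ) (j : Fin p) :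
    elasticNet μ X lam y j ≠ 0 ↔ lam < |(Xᵀ *ᵥ y) j -
      ρ / (1 + μ) * ∑ k ∈ partners j, softThreshold lam ((Xᵀ *ᵥ y) k)| :=
  IsMinOn.ne_zero_iff hρ hμ hX hlam
    (Classical.epsilon_spec (exists_isMinOn_elasticNetObjective hρ hμ hX hlam y)) j

end Minimizer

/-! ### The geometry of a block, in whitened coordinates -/

/-- The second coordinate of a whitened pair with correlation `ρ`; the first one is the real
part. -/
def sndCoord (ρ : ℝ) (w : ℂ) : ℝ := ρ * w.re + Real.sqrt (1 - ρ ^ 2) * w.im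

/-- The whitened point with given coordinates. -/
def ofCoords (ρ x₁ x₂ : ℝ) : ℂ := ⟨x₁, (x₂ - ρ * x₁) / Real.sqrt (1 - ρ ^ 2)⟩

/-- The whitened mean of the pair when the signals are `b₁` and `b₂`. -/
def center (ρ b₁ b₂ : ℝ) : ℂ := ofCoords ρ (b₁ + ρ * b₂) (ρ * b₁ + b₂)

/-- The set of whitened pairs for which the first variable of the block is selected at
level `s`. -/
def selected (ρ η s : ℝ) : Set ℂ :=
  {w | s < |w.re - η * softThreshold s (sndCoord ρ w)|}

/-- The standard deviation of `x₁ - η x₂` for standard normal `x₁`, `x₂` with correlation `ρ`. -/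
def contrastNorm (ρ η : ℝ) : ℝ := Real.sqrt (1 + η ^ 2 - 2 * ρ * η)

section Plane

open scoped Pointwise

variable {ρ η s : ℝ}

lemma one_sub_sq_pos (hρ : |ρ| < 1) : 0 < 1 - ρ ^ 2 := by
  have := (sq_lt_one_iff_abs_lt_one ρ).2 hρ
  linarith

lemma sqrt_one_sub_sq_pos (hρ : |ρ| < 1) : 0 < Real.sqrt (1 - ρ ^ 2) :=
  Real.sqrt_pos.2 (one_sub_sq_pos hρ)

lemma continuous_sndCoord (ρ : ℝ) : Continuous (sndCoord ρ) := by
  unfold sndCoord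
  exact (continuous_const.mul Complex.continuous_re).add
    (continuous_const.mul Complex.continuous_im)

@[simp]
lemma ofCoords_re (ρ x₁ x₂ : ℝ) : (ofCoords ρ x₁ x₂).re = x₁ := rfl

lemma sndCoord_ofCoords (hρ : |ρ| < 1) (x₁ x₂ : ℝ) : sndCoord ρ (ofCoords ρ x₁ x₂) = x₂ := by
  have := (sqrt_one_sub_sq_pos hρ).ne'
  unfold sndCoord ofCoords
  simp only
  field_simp
  ring

lemma ofCoords_re_sndCoord (hρ : |ρ| < 1) (w : ℂ) : ofCoords ρ w.re (sndCoord ρ w) = w := by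
  have := (sqrt_one_sub_sq_pos hρ).ne'
  unfold sndCoord ofCoords
  apply Complex.ext
  · rfl
  · simp only
    field_simp
    ring

lemma ofCoords_mul (ρ c x₁ x₂ : ℝ) : ofCoords ρ (c * x₁) (c * x₂) = c • ofCoords ρ x₁ x₂ := by
  apply Complex.ext
  · simp
  · simp only [ofCoords, Complex.smul_im, smul_eq_mul]
    ring

lemma center_mul (ρ c b₁ b₂ : ℝ) : center ρ (c * b₁) (c * b₂) = c • center ρ b₁ b₂ := by
  rw [center, center, ← ofCoords_mul]
  congr 1 <;> ring

lemma continuous_center (ρ : ℝ) : Continuous fun b : ℝ × ℝ => center ρ b.1 b.2 := by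
  have h : (fun b : ℝ × ℝ => center ρ b.1 b.2) = fun b : ℝ × ℝ => Complex.equivRealProdCLM.symm
      (b.1 + ρ * b.2, (ρ * b.1 + b.2 - ρ * (b.1 + ρ * b.2)) / Real.sqrt (1 - ρ ^ 2)) := rfl
  rw [h]
  fun_prop

lemma contrast_sq_pos (hρ : |ρ| < 1) : 0 < 1 + η ^ 2 - 2 * ρ * η := by
  have := one_sub_sq_pos hρ
  nlinarith [sq_nonneg (η - ρ)]

lemma contrastNorm_pos (hρ : |ρ| < 1) : 0 < contrastNorm ρ η :=
  Real.sqrt_pos.2 (contrast_sq_pos hρ)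

lemma contrastNorm_sq (hρ : |ρ| < 1) : contrastNorm ρ η ^ 2 = 1 + η ^ 2 - 2 * ρ * η :=
  Real.sq_sqrt (contrast_sq_pos hρ).le

/-- Cauchy–Schwarz in whitened coordinates: the norm of the functional `α x₁ + β x₂` is its standard
deviation under correlation `ρ`. All lower bounds on distances rest on it. -/
lemma abs_linear_le_dist (hρ : |ρ| < 1) (α β : ℝ) (m w : ℂ) :
    |α * (w.re - m.re) + β * (sndCoord ρ w - sndCoord ρ m)| ≤
      Real.sqrt (α ^ 2 + β ^ 2 + 2 * ρ * α * β) * dist m w := by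
  have hsq : Real.sqrt (1 - ρ ^ 2) ^ 2 = 1 - ρ ^ 2 := Real.sq_sqrt (one_sub_sq_pos hρ).le
  have hpos : 0 ≤ α ^ 2 + β ^ 2 + 2 * ρ * α * β := by
    nlinarith [sq_nonneg (α + ρ * β), sq_nonneg β, one_sub_sq_pos hρ,
      mul_nonneg (sq_nonneg β) (one_sub_sq_pos hρ).le]
  rw [Complex.dist_eq_re_im, ← Real.sqrt_mul hpos]
  apply Real.abs_le_sqrt
  unfold sndCoord
  set k := Real.sqrt (1 - ρ ^ 2)
  set u := w.re - m.re with hu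
  set v := w.im - m.im with hv
  have h1 : α * u + β * (ρ * w.re + k * w.im - (ρ * m.re + k * m.im)) =
      (α + β * ρ) * u + β * k * v := by rw [hu, hv]; ring
  have h2 : (α ^ 2 + β ^ 2 + 2 * ρ * α * β) = (α + β * ρ) ^ 2 + (β * k) ^ 2 := by
    rw [mul_pow, hsq]; ring
  have h3 : (m.re - w.re) ^ 2 + (m.im - w.im) ^ 2 = u ^ 2 + v ^ 2 := by rw [hu, hv]; ring
  rw [h1, h2, h3]
  nlinarith [sq_nonneg ((α + β * ρ) * v - β * k * u)]

lemma abs_re_sub_le_dist (m w : ℂ) : |w.re - m.re| ≤ dist m w := by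
  rw [dist_comm, dist_eq_norm, ← Complex.sub_re]
  exact Complex.abs_re_le_norm _

lemma abs_sndCoord_sub_le_dist (hρ : |ρ| < 1) (m w : ℂ) :
    |sndCoord ρ w - sndCoord ρ m| ≤ dist m w := by
  simpa using abs_linear_le_dist hρ 0 1 m w

lemma abs_contrast_le_dist (hρ : |ρ| < 1) (η : ℝ) (m w : ℂ) :
    |(w.re - η * sndCoord ρ w) - (m.re - η * sndCoord ρ m)| ≤ contrastNorm ρ η * dist m w := by
  have h := abs_linear_le_dist hρ 1 (-η) m w
  rw [show 1 * (w.re - m.re) + -η * (sndCoord ρ w - sndCoord ρ m) =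
    (w.re - η * sndCoord ρ w) - (m.re - η * sndCoord ρ m) by ring,
    show (1 : ℝ) ^ 2 + (-η) ^ 2 + 2 * ρ * 1 * -η = 1 + η ^ 2 - 2 * ρ * η by ring] at h
  exact h

/-- The direction normal to the lines on which `x₁ - η x₂` is constant. -/
lemma dist_ofCoords_normal (hρ : |ρ| < 1) (η x₁ x₂ t : ℝ) :
    dist (ofCoords ρ x₁ x₂) (ofCoords ρ (x₁ + t * (1 - η * ρ)) (x₂ + t * (ρ - η))) =
      |t| * contrastNorm ρ η := by
  have hsq : Real.sqrt (1 - ρ ^ 2) ^ 2 = 1 - ρ ^ 2 := Real.sq_sqrt (one_sub_sq_pos hρ).le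
  have hne := (sqrt_one_sub_sq_pos hρ).ne'
  rw [Complex.dist_eq_re_im, contrastNorm, ← Real.sqrt_sq_eq_abs, ← Real.sqrt_mul (sq_nonneg t)]
  congr 1
  unfold ofCoords
  simp only
  set k := Real.sqrt (1 - ρ ^ 2)
  have h1 : (x₂ - ρ * x₁) / k - (x₂ + t * (ρ - η) - ρ * (x₁ + t * (1 - η * ρ))) / k =
      t * η * k := by
    field_simp
    rw [hsq]
    ring
  rw [h1, mul_pow _ k, hsq]
  ring

lemma dist_ofCoords_first (ρ x y : ℝ) :
    dist (ofCoords ρ x (ρ * x)) (ofCoords ρ y (ρ * y)) = |x - y| := by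
  rw [Complex.dist_eq_re_im]
  simp [ofCoords, Real.sqrt_sq_eq_abs]

lemma isOpen_selected (ρ η s : ℝ) : IsOpen (selected ρ η s) :=
  isOpen_lt continuous_const (Complex.continuous_re.sub (continuous_const.mul
    ((continuous_softThreshold s).comp (continuous_sndCoord ρ)))).abs

lemma selected_nonempty (hρ : |ρ| < 1) (hs : 0 ≤ s) : (selected ρ η s).Nonempty := by
  refine ⟨ofCoords ρ (s + 1) 0, ?_⟩
  rw [selected, Set.mem_ofPred_eq, sndCoord_ofCoords hρ,
    (softThreshold_eq_zero_iff hs).2 (by simpa using hs), ofCoords_re, mul_zero, sub_zero]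
  exact (lt_add_one s).trans_le (le_abs_self _)

lemma zero_mem_compl_selected (hs : 0 ≤ s) : (0 : ℂ) ∈ (selected ρ η s)ᶜ := by
  have h : sndCoord ρ 0 = 0 := by simp [sndCoord]
  simp only [selected, Set.mem_compl_iff, Set.mem_ofPred_eq, not_lt, h]
  rw [(softThreshold_eq_zero_iff hs).2 (by simpa using hs)]
  simpa using hs

/-- Soft thresholding is positively homogeneous, so the factor `√(2 log p)` can be taken out of the
region. -/
lemma smul_selected {c : ℝ} (hc : 0 < c) (ρ η s : ℝ) :
    c • selected ρ η s = selected ρ η (c * s) := by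
  ext w
  rw [Set.mem_smul_set_iff_inv_smul_mem₀ hc.ne']
  have h1 : w = c • (c⁻¹ • w) := by rw [smul_inv_smul₀ hc.ne']
  set v := c⁻¹ • w
  have h2 : sndCoord ρ w = c * sndCoord ρ v := by
    rw [h1]; simp only [sndCoord, Complex.smul_re, Complex.smul_im, smul_eq_mul]; ring
  have h3 : w.re = c * v.re := by rw [h1]; simp
  simp only [selected, Set.mem_ofPred_eq]
  rw [h2, h3, softThreshold_mul hc.le, mul_left_comm η, ← mul_sub, abs_mul, abs_of_pos hc,
    mul_lt_mul_iff_right₀ hc]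

lemma smul_compl_selected {c : ℝ} (hc : 0 < c) (ρ η s : ℝ) :
    c • (selected ρ η s)ᶜ = (selected ρ η (c * s))ᶜ := by
  rw [← smul_selected hc]
  ext w
  simp only [Set.mem_compl_iff, Set.mem_smul_set_iff_inv_smul_mem₀ hc.ne']

/-- The closed error region of false negatives is the closure of its interior. -/
lemma compl_selected_subset_closure (hρ : |ρ| < 1) (hs : 0 < s) :
    (selected ρ η s)ᶜ ⊆
      closure {w | |w.re - η * softThreshold s (sndCoord ρ w)| < s} := by
  intro w hw
  simp only [selected, Set.mem_compl_iff, Set.mem_ofPred_eq, not_lt] at hw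
  set φ := w.re - η * softThreshold s (sndCoord ρ w) with hφ
  -- Moving the first coordinate by `-δ φ` with the second one fixed multiplies `φ` by `1 - δ`,
  -- which makes the inequality strict as soon as `0 < δ < 1`.
  have hcont : Continuous fun δ : ℝ => ofCoords ρ (w.re - δ * φ) (sndCoord ρ w) := by
    have h : (fun δ : ℝ => ofCoords ρ (w.re - δ * φ) (sndCoord ρ w)) =
        fun δ : ℝ => Complex.equivRealProdCLM.symm (w.re - δ * φ,
          (sndCoord ρ w - ρ * (w.re - δ * φ)) / Real.sqrt (1 - ρ ^ 2)) := rfl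
    rw [h]
    fun_prop
  have htend : Tendsto (fun δ : ℝ => ofCoords ρ (w.re - δ * φ) (sndCoord ρ w)) (𝓝[>] 0) (𝓝 w) := by
    have h := (hcont.tendsto 0).mono_left (nhdsWithin_le_nhds (s := Set.Ioi 0))
    rwa [zero_mul, sub_zero, ofCoords_re_sndCoord hρ] at h
  refine mem_closure_of_tendsto htend ?_
  filter_upwards [Ioo_mem_nhdsGT (show (0 : ℝ) < 1 by norm_num)] with δ hδ
  rw [sndCoord_ofCoords hρ, ofCoords_re,
    show w.re - δ * φ - η * softThreshold s (sndCoord ρ w) = (1 - δ) * φ by rw [hφ]; ring,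
    abs_mul, abs_of_pos (by linarith [hδ.2])]
  nlinarith [hδ.1, hδ.2, abs_nonneg φ]

/-! ### Distances to the error regions -/

/-- The distance from the mean to the region of false positives, when the other signal of the
block is `b`. -/
def fpDist (ρ η s b : ℝ) : ℝ := Metric.infDist (center ρ 0 b) (selected ρ η s)

/-- The distance from the mean to the region of false negatives, when the signal is `R` and
the other signal of the block is `b`. -/
def fnDist (ρ η s R b : ℝ) : ℝ := Metric.infDist (center ρ R b) (selected ρ η s)ᶜ

lemma fpDist_nonneg (ρ η s b : ℝ) : 0 ≤ fpDist ρ η s b := Metric.infDist_nonneg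

lemma fnDist_nonneg (ρ η s R b : ℝ) : 0 ≤ fnDist ρ η s R b := Metric.infDist_nonneg

lemma fpDist_mul {c : ℝ} (hc : 0 < c) (ρ η s b : ℝ) :
    fpDist ρ η (c * s) (c * b) = c * fpDist ρ η s b := by
  unfold fpDist
  rw [← smul_selected hc, ← mul_zero c, center_mul, infDist_smul₀ hc.ne', Real.norm_eq_abs,
    abs_of_pos hc, mul_zero]

lemma fnDist_mul {c : ℝ} (hc : 0 < c) (ρ η s R b : ℝ) :
    fnDist ρ η (c * s) (c * R) (c * b) = c * fnDist ρ η s R b := by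
  unfold fnDist
  rw [← smul_compl_selected hc, center_mul, infDist_smul₀ hc.ne',
    Real.norm_eq_abs, abs_of_pos hc]

/-- By homogeneity the region can be kept at level `1` while the point moves, and the distance to a
fixed set is continuous in the point. -/
lemma continuousOn_fpDist (ρ η b : ℝ) : ContinuousOn (fun s => fpDist ρ η s b) (Set.Ioi 0) := by
  have h : ContinuousOn (fun s : ℝ => s * fpDist ρ η 1 (s⁻¹ * b)) (Set.Ioi 0) := by
    refine continuousOn_id.mul ?_
    have h1 : ContinuousOn (fun s : ℝ => ((0 : ℝ), s⁻¹ * b)) (Set.Ioi 0) :=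
      continuousOn_const.prodMk ((continuousOn_inv₀.mono fun s hs => (ne_of_gt hs)).mul
        continuousOn_const)
    exact (Metric.continuous_infDist_pt _).comp_continuousOn
      ((continuous_center ρ).comp_continuousOn h1)
  refine h.congr fun s hs => ?_
  have hs' : s ≠ 0 := ne_of_gt hs
  simp only
  rw [← fpDist_mul hs, mul_one, mul_inv_cancel_left₀ hs']

lemma continuousOn_fnDist (ρ η R b : ℝ) :
    ContinuousOn (fun s => fnDist ρ η s R b) (Set.Ioi 0) := by
  have h : ContinuousOn (fun s : ℝ => s * fnDist ρ η 1 (s⁻¹ * R) (s⁻¹ * b)) (Set.Ioi 0) := by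
    refine continuousOn_id.mul ?_
    have h0 : ContinuousOn (fun s : ℝ => s⁻¹) (Set.Ioi 0) :=
      continuousOn_inv₀.mono fun s hs => (ne_of_gt hs)
    have h1 : ContinuousOn (fun s : ℝ => (s⁻¹ * R, s⁻¹ * b)) (Set.Ioi 0) :=
      (h0.mul continuousOn_const).prodMk (h0.mul continuousOn_const)
    exact (Metric.continuous_infDist_pt _).comp_continuousOn
      ((continuous_center ρ).comp_continuousOn h1)
  refine h.congr fun s hs => ?_
  have hs' : s ≠ 0 := ne_of_gt hs
  simp only
  rw [← fnDist_mul hs, mul_one, mul_inv_cancel_left₀ hs', mul_inv_cancel_left₀ hs']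

/-- A selected point has `|x₁| > s` or `|x₂| > s`, and both coordinates are 1-Lipschitz. Conversely,
on the ray `x₂ = ρ x₁` the partner is still thresholded to zero when `x₁` passes `s`. -/
lemma fpDist_zero (hρ : |ρ| < 1) (η : ℝ) (hs : 0 < s) : fpDist ρ η s 0 = s := by
  have hc : center ρ 0 0 = ofCoords ρ 0 (ρ * 0) := by simp [center]
  apply le_antisymm
  · refine le_of_forall_pos_le_add fun ε hε => ?_
    -- The cap keeps the partner below the level: `|ρ| (s + δ) ≤ s (1 - (1 - |ρ|)²) ≤ s`.
    set δ := min ε (s * (1 - |ρ|)) with hδ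
    have hδ0 : 0 < δ := lt_min hε (mul_pos hs (by linarith))
    have hδ1 : δ ≤ s * (1 - |ρ|) := min_le_right _ _
    have hmem : ofCoords ρ (s + δ) (ρ * (s + δ)) ∈ selected ρ η s := by
      have h1 : |ρ * (s + δ)| ≤ s := by
        rw [abs_mul, abs_of_pos (by linarith : 0 < s + δ)]
        nlinarith [abs_nonneg ρ, mul_nonneg hs.le (sq_nonneg (1 - |ρ|)),
          mul_le_mul_of_nonneg_left hδ1 (abs_nonneg ρ)]
      rw [selected, Set.mem_ofPred_eq, sndCoord_ofCoords hρ,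
        (softThreshold_eq_zero_iff hs.le).2 h1, ofCoords_re, mul_zero, sub_zero]
      exact (lt_add_of_pos_right s hδ0).trans_le (le_abs_self _)
    refine (Metric.infDist_le_dist_of_mem hmem).trans ?_
    rw [hc, dist_ofCoords_first, zero_sub, abs_neg, abs_of_pos (by linarith)]
    linarith [min_le_left ε (s * (1 - |ρ|))]
  · rw [fpDist, Metric.le_infDist (selected_nonempty hρ hs.le)]
    intro w hw
    have h1 := abs_re_sub_le_dist (center ρ 0 0) w
    have h2 := abs_sndCoord_sub_le_dist hρ (center ρ 0 0) w
    rw [hc, sndCoord_ofCoords hρ, mul_zero, sub_zero] at h2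
    rw [hc, ofCoords_re, sub_zero, mul_zero] at h1
    rw [hc, mul_zero]
    by_cases h3 : |sndCoord ρ w| ≤ s
    · rw [selected, Set.mem_ofPred_eq, (softThreshold_eq_zero_iff hs.le).2 h3, mul_zero,
        sub_zero] at hw
      linarith
    · linarith

/-- Soft thresholding moves `x₂` by at most `s`, so `|x₁ - η x₂| > (1 - |η|) s` on the region; this
contrast equals `(ρ - η) b` at the mean and is Lipschitz with constant `contrastNorm ρ η`. -/
lemma le_fpDist (hρ : |ρ| < 1) (hs : 0 ≤ s) (b : ℝ) :
    ((1 - |η|) * s - |(ρ - η) * b|) / contrastNorm ρ η ≤ fpDist ρ η s b := by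
  rw [fpDist, Metric.le_infDist (selected_nonempty hρ hs)]
  intro w hw
  rw [div_le_iff₀' (contrastNorm_pos hρ)]
  refine le_trans ?_ (abs_contrast_le_dist hρ η _ w)
  rw [center, sndCoord_ofCoords hρ, ofCoords_re]
  rw [selected, Set.mem_ofPred_eq] at hw
  have h1 : |η * (sndCoord ρ w - softThreshold s (sndCoord ρ w))| ≤ |η| * s := by
    rw [abs_mul]
    exact mul_le_mul_of_nonneg_left (abs_sub_softThreshold_le hs _) (abs_nonneg _)
  have h2 : w.re - η * softThreshold s (sndCoord ρ w) =
      (w.re - η * sndCoord ρ w - (0 + ρ * b - η * (ρ * 0 + b))) + (ρ - η) * b +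
        η * (sndCoord ρ w - softThreshold s (sndCoord ρ w)) := by ring
  have h3 := abs_add_three (w.re - η * sndCoord ρ w - (0 + ρ * b - η * (ρ * 0 + b)))
    ((ρ - η) * b) (η * (sndCoord ρ w - softThreshold s (sndCoord ρ w)))
  rw [← h2] at h3
  linarith

/-- A common sign allows positive and negative correlation to be treated in one computation. -/
lemma exists_common_sign (hη : |η| ≤ |ρ|) (hρη : 0 ≤ ρ * η) :
    ∃ σ : ℝ, |σ| = 1 ∧ σ * σ = 1 ∧ ρ = σ * |ρ| ∧ η = σ * |η| := by
  rcases lt_trichotomy ρ 0 with h | h | h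
  · refine ⟨-1, by simp, by simp, by rw [abs_of_neg h]; ring, ?_⟩
    rw [abs_of_nonpos (by by_contra h'; push Not at h'; nlinarith)]; ring
  · have : η = 0 := by simpa [h] using hη
    exact ⟨1, by simp, by simp, by simp [h], by simp [this]⟩
  · refine ⟨1, by simp, by simp, by rw [abs_of_pos h, one_mul], ?_⟩
    rw [abs_of_nonneg (by by_contra h'; push Not at h'; nlinarith), one_mul]

/-- Matches `le_fpDist`: for `x₂ ≥ s` the boundary of the region is a line on which `x₁ - η x₂` is
constant. The move from the mean along its normal starts at `x₂ = R ≥ s` and does not decrease `x₂`.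
-/
lemma fpDist_le (hρ : |ρ| < 1) (hη : |η| ≤ |ρ|) (hρη : 0 ≤ ρ * η) (hs : 0 ≤ s) {R : ℝ}
    (hR : s ≤ R) :
    fpDist ρ η s R ≤ max 0 ((1 - |η|) * s - (|ρ| - |η|) * R) / contrastNorm ρ η := by
  obtain ⟨σ, hσ1, hσ2, hρσ, hησ⟩ := exists_common_sign hη hρη
  set a := |ρ|
  set e := |η|
  set M := max 0 ((1 - e) * s - (a - e) * R) with hM
  have hκ := contrastNorm_pos (η := η) hρ
  set κ := contrastNorm ρ η with hκdef
  refine le_of_forall_pos_le_add fun ε hε => ?_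
  -- A normal step of parameter `t` has length `t κ` and changes the contrast by `t κ²`; the extra
  -- `ε` makes the point selected strictly.
  set t := (M / κ + ε) / κ with ht
  have ht0 : 0 < t := div_pos (add_pos_of_nonneg_of_pos (div_nonneg (le_max_left _ _) hκ.le) hε) hκ
  have htκ : t * κ = M / κ + ε := by rw [ht]; field_simp
  have htκ2 : t * κ ^ 2 = M + ε * κ := by
    rw [sq, ← mul_assoc, htκ]; field_simp
  have hκ2 : κ ^ 2 = 1 + e ^ 2 - 2 * a * e := by
    rw [hκdef, contrastNorm_sq hρ, hρσ, hησ]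
    linear_combination (e ^ 2 - 2 * a * e) * hσ2
  have hx : s ≤ R + σ * t * (ρ - η) := by
    rw [hρσ, hησ, show σ * t * (σ * a - σ * e) = (σ * σ) * (t * (a - e)) by ring, hσ2, one_mul]
    nlinarith [mul_nonneg ht0.le (sub_nonneg.2 hη)]
  have hmem : ofCoords ρ (ρ * R + σ * t * (1 - η * ρ)) (R + σ * t * (ρ - η)) ∈
      selected ρ η s := by
    rw [selected, Set.mem_ofPred_eq, sndCoord_ofCoords hρ, ofCoords_re, softThreshold_of_le hs hx]
    have h1 : ρ * R + σ * t * (1 - η * ρ) - η * (R + σ * t * (ρ - η) - s) =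
        σ * ((a - e) * R + e * s + t * κ ^ 2) := by
      rw [hκ2, hρσ, hησ]
      linear_combination (σ * t * (e ^ 2 - 2 * a * e)) * hσ2
    rw [h1, abs_mul, hσ1, one_mul, htκ2]
    refine lt_of_lt_of_le ?_ (le_abs_self _)
    have := le_max_right 0 ((1 - e) * s - (a - e) * R)
    have := mul_pos hε hκ
    linarith
  have hc : center ρ 0 R = ofCoords ρ (ρ * R) R := by simp [center]
  refine (Metric.infDist_le_dist_of_mem hmem).trans ?_
  rw [hc, dist_ofCoords_normal hρ, abs_mul, hσ1, one_mul, abs_of_pos ht0, htκ]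

/-- Lowering `x₁` to `min R s` along `x₂ = ρ x₁` leaves the partner thresholded to zero and the
signal missed. -/
lemma fnDist_zero_le (hρ : |ρ| < 1) (hs : 0 ≤ s) {R : ℝ} (hR : 0 ≤ R) :
    fnDist ρ η s R 0 ≤ max 0 (R - s) := by
  have h0 : 0 ≤ min R s := le_min hR hs
  have hmem : ofCoords ρ (min R s) (ρ * min R s) ∈ (selected ρ η s)ᶜ := by
    have h1 : |ρ * min R s| ≤ s := by
      rw [abs_mul, abs_of_nonneg h0]
      nlinarith [min_le_right R s, abs_nonneg ρ]
    rw [selected, Set.mem_compl_iff, Set.mem_ofPred_eq, sndCoord_ofCoords hρ,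
      (softThreshold_eq_zero_iff hs).2 h1, ofCoords_re, mul_zero, sub_zero, abs_of_nonneg h0,
      not_lt]
    exact min_le_right R s
  have hc : center ρ R 0 = ofCoords ρ R (ρ * R) := by simp [center]
  refine (Metric.infDist_le_dist_of_mem hmem).trans ?_
  rw [hc, dist_ofCoords_first, abs_of_nonneg (by linarith [min_le_left R s])]
  rcases min_cases R s with h | h
  · rw [h.1, sub_self]; exact le_max_left _ _
  · rw [h.1]; exact le_max_right _ _

/-- The two half-planes are the two cases of the maximum in `mul_softThreshold_le`. Their union
contains the unselected set, so the smaller of their distances bounds the distance in `le_fnDist`.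
-/
lemma le_or_contrast_le_of_notMem_selected {w : ℂ} (hw : w ∈ (selected ρ η s)ᶜ) :
    w.re ≤ s ∨ w.re - η * sndCoord ρ w ≤ (1 - |η|) * s := by
  simp only [selected, Set.mem_compl_iff, Set.mem_ofPred_eq, not_lt] at hw
  have h1 := (abs_le.1 hw).2
  have h2 := mul_softThreshold_le s η (sndCoord ρ w)
  rcases max_cases 0 (η * sndCoord ρ w - |η| * s) with h | h
  · left; linarith
  · right; linarith

lemma contrast_le_of_notMem_selected (hs : 0 ≤ s) {w : ℂ} (hw : w ∈ (selected ρ η s)ᶜ) :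
    w.re - η * sndCoord ρ w ≤ (1 + |η|) * s := by
  simp only [selected, Set.mem_compl_iff, Set.mem_ofPred_eq, not_lt] at hw
  have h1 := (abs_le.1 hw).2
  have h2 : |η * (sndCoord ρ w - softThreshold s (sndCoord ρ w))| ≤ |η| * s := by
    rw [abs_mul]
    exact mul_le_mul_of_nonneg_left (abs_sub_softThreshold_le hs _) (abs_nonneg _)
  have h3 := (abs_le.1 h2).1
  linarith

lemma le_fnDist (hρ : |ρ| < 1) (hs : 0 ≤ s) (R b : ℝ) :
    min (R + ρ * b - s)
      ((((1 - ρ * η) * R + (ρ - η) * b) - (1 - |η|) * s) / contrastNorm ρ η) ≤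
      fnDist ρ η s R b := by
  rw [fnDist, Metric.le_infDist ⟨0, zero_mem_compl_selected hs⟩]
  intro w hw
  rcases le_or_contrast_le_of_notMem_selected hw with h | h
  · refine (min_le_left _ _).trans (le_trans ?_ (abs_re_sub_le_dist _ w))
    rw [center, ofCoords_re, abs_sub_comm]
    refine le_trans ?_ (le_abs_self _)
    linarith
  · refine (min_le_right _ _).trans ?_
    rw [div_le_iff₀' (contrastNorm_pos hρ)]
    refine le_trans ?_ (abs_contrast_le_dist hρ η _ w)
    rw [center, sndCoord_ofCoords hρ, ofCoords_re, abs_sub_comm]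
    refine le_trans ?_ (le_abs_self _)
    linarith

/-- With negative correlation two signals partly cancel: both coordinates of the mean are `(1 - |ρ|)
R`, where the contrast is `(1 + |η|) (1 - |ρ|) R`. It must fall to `(1 + |η|) s`. -/
lemma le_fnDist_of_neg (hρ : |ρ| < 1) (hρη : 0 ≤ ρ * η) (hρ0 : ρ < 0)
    (hs : 0 ≤ s) (R : ℝ) :
    (1 + |η|) * ((1 - |ρ|) * R - s) / contrastNorm ρ η ≤ fnDist ρ η s R R := by
  have hη0 : η ≤ 0 := by by_contra h'; push Not at h'; nlinarith
  rw [fnDist, Metric.le_infDist ⟨0, zero_mem_compl_selected hs⟩]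
  intro w hw
  have h := contrast_le_of_notMem_selected hs hw
  rw [div_le_iff₀' (contrastNorm_pos hρ)]
  refine le_trans ?_ (abs_contrast_le_dist hρ η _ w)
  rw [center, sndCoord_ofCoords hρ, ofCoords_re, abs_sub_comm]
  refine le_trans ?_ (le_abs_self _)
  rw [abs_of_nonpos hη0] at h ⊢
  rw [abs_of_neg hρ0]
  linarith

/-- A mean with coordinates at most `s` is already unselected. Otherwise its projection to the line
bounding the half-plane of `le_fnDist_of_neg` is used; since `ρ ≤ η` the projection does not lower
`x₂`, so it stays where that line bounds the region. -/
lemma fnDist_le_of_neg (hρ : |ρ| < 1) (hη : |η| ≤ |ρ|) (hρη : 0 ≤ ρ * η) (hρ0 : ρ < 0)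
    (hs : 0 ≤ s) {R : ℝ} (hR : 0 ≤ R) :
    fnDist ρ η s R R ≤ max 0 ((1 + |η|) * ((1 - |ρ|) * R - s)) / contrastNorm ρ η := by
  have hη0 : η ≤ 0 := by by_contra h'; push Not at h'; nlinarith
  have hc : center ρ R R = ofCoords ρ ((1 + ρ) * R) ((1 + ρ) * R) := by
    rw [center]; congr 1 <;> ring
  have hA0 : 0 ≤ (1 + ρ) * R := mul_nonneg (by linarith [(abs_lt.1 hρ).1]) hR
  rw [abs_of_nonpos hη0, abs_of_neg hρ0] at *
  have hκ := contrastNorm_pos (η := η) (abs_lt.2 ⟨by linarith, by linarith⟩ : |ρ| < 1)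
  have hκ2 := contrastNorm_sq (η := η) (abs_lt.2 ⟨by linarith, by linarith⟩ : |ρ| < 1)
  have hρ' : |ρ| < 1 := abs_lt.2 ⟨by linarith, by linarith⟩
  rw [sub_neg_eq_add, fnDist, hc]
  set A := (1 + ρ) * R
  rcases le_or_gt A s with h | h
  · have hmem : ofCoords ρ A A ∈ (selected ρ η s)ᶜ := by
      rw [selected, Set.mem_compl_iff, Set.mem_ofPred_eq, sndCoord_ofCoords hρ',
        (softThreshold_eq_zero_iff hs).2 (by rwa [abs_of_nonneg hA0]), ofCoords_re, mul_zero,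
        sub_zero, abs_of_nonneg hA0, not_lt]
      exact h
    rw [Metric.infDist_zero_of_mem hmem]
    exact div_nonneg (le_max_left _ _) hκ.le
  · set κ := contrastNorm ρ η
    set t := (1 + -η) * (A - s) / κ ^ 2 with ht
    have ht0 : 0 ≤ t := div_nonneg (mul_nonneg (by linarith) (by linarith)) (sq_nonneg _)
    have htκ : t * κ ^ 2 = (1 + -η) * (A - s) := by rw [ht]; field_simp
    have hx : s ≤ A + -t * (ρ - η) := by nlinarith [mul_nonneg ht0 (by linarith : 0 ≤ η - ρ)]
    have hmem : ofCoords ρ (A + -t * (1 - η * ρ)) (A + -t * (ρ - η)) ∈ (selected ρ η s)ᶜ := by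
      have h1 : A + -t * (1 - η * ρ) - η * (A + -t * (ρ - η) - s) = s := by
        rw [hκ2] at htκ
        linear_combination -htκ
      rw [selected, Set.mem_compl_iff, Set.mem_ofPred_eq, sndCoord_ofCoords hρ', ofCoords_re,
        softThreshold_of_le hs hx, h1, abs_of_nonneg hs]
      exact lt_irrefl s
    refine (Metric.infDist_le_dist_of_mem hmem).trans ?_
    rw [dist_ofCoords_normal hρ', abs_neg, abs_of_nonneg ht0, le_div_iff₀ hκ, mul_assoc, ← sq, htκ]
    exact le_max_right _ _

end Plane

/-! ### The Hamming exponent -/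

/-- The Hamming exponent: the smallest of the exponents of the probabilities of the two kinds of
errors, for each of the two possible values of the other signal of the block. -/
def blockExponent (ρ η q ϑ r : ℝ) : ℝ :=
  min (min (fpDist ρ η √q 0 ^ 2) (ϑ + fpDist ρ η √q √r ^ 2))
    (min (ϑ + fnDist ρ η √q √r 0 ^ 2) (2 * ϑ + fnDist ρ η √q √r √r ^ 2))

section Exponent

variable {ρ η ϑ r : ℝ}

lemma lt_blockExponent_iff (hρ : |ρ| < 1) {q : ℝ} (hq : 0 < q) (c : ℝ) :
    c < blockExponent ρ η q ϑ r ↔ c < q ∧ c < ϑ + fpDist ρ η √q √r ^ 2 ∧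
      c < ϑ + fnDist ρ η √q √r 0 ^ 2 ∧ c < 2 * ϑ + fnDist ρ η √q √r √r ^ 2 := by
  rw [blockExponent, fpDist_zero hρ η (Real.sqrt_pos.2 hq), Real.sq_sqrt hq.le, lt_min_iff,
    lt_min_iff, lt_min_iff, and_assoc]

lemma blockExponent_le_tuning (hρ : |ρ| < 1) {q : ℝ} (hq : 0 < q) :
    blockExponent ρ η q ϑ r ≤ q := by
  refine (min_le_left _ _).trans ((min_le_left _ _).trans ?_)
  rw [fpDist_zero hρ η (Real.sqrt_pos.2 hq), Real.sq_sqrt hq.le]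

lemma blockExponent_le_single (hρ : |ρ| < 1) (q : ℝ) :
    blockExponent ρ η q ϑ r ≤ ϑ + max 0 (√r - √q) ^ 2 := by
  refine (min_le_right _ _).trans ((min_le_left _ _).trans ?_)
  have := pow_le_pow_left₀ (fnDist_nonneg ρ η √q √r 0)
    (fnDist_zero_le (η := η) hρ (Real.sqrt_nonneg q) (Real.sqrt_nonneg r)) 2
  linarith

lemma blockExponent_le_of_le (hρ : |ρ| < 1) {q : ℝ} (hqr : r ≤ q) :
    blockExponent ρ η q ϑ r ≤ ϑ := by
  have := blockExponent_le_single (η := η) (ϑ := ϑ) (r := r) hρ q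
  rw [max_eq_left (sub_nonpos.2 (Real.sqrt_le_sqrt hqr))] at this
  linarith

lemma blockExponent_eq_of_le (hρ : |ρ| < 1) (hϑ : 0 < ϑ) {q : ℝ} (hqr : r ≤ q) (hqϑ : ϑ ≤ q) :
    blockExponent ρ η q ϑ r = ϑ := by
  refine le_antisymm (blockExponent_le_of_le hρ hqr) (le_min (le_min ?_ ?_) (le_min ?_ ?_))
  · rw [fpDist_zero hρ η (Real.sqrt_pos.2 (hϑ.trans_le hqϑ)), Real.sq_sqrt (hϑ.le.trans hqϑ)]
    exact hqϑ
  · linarith [sq_nonneg (fpDist ρ η √q √r)]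
  · linarith [sq_nonneg (fnDist ρ η √q √r 0)]
  · linarith [sq_nonneg (fnDist ρ η √q √r √r)]

lemma continuousOn_blockExponent (ρ η ϑ r : ℝ) :
    ContinuousOn (fun q => blockExponent ρ η q ϑ r) (Set.Ioi 0) := by
  have h : ContinuousOn (fun s : ℝ => min (min (fpDist ρ η s 0 ^ 2) (ϑ + fpDist ρ η s √r ^ 2))
      (min (ϑ + fnDist ρ η s √r 0 ^ 2) (2 * ϑ + fnDist ρ η s √r √r ^ 2))) (Set.Ioi 0) :=
    ContinuousOn.inf
      (ContinuousOn.inf ((continuousOn_fpDist ρ η 0).pow 2)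
        (continuousOn_const.add ((continuousOn_fpDist ρ η √r).pow 2)))
      (ContinuousOn.inf (continuousOn_const.add ((continuousOn_fnDist ρ η √r 0).pow 2))
        (continuousOn_const.add ((continuousOn_fnDist ρ η √r √r).pow 2)))
  exact h.comp Real.continuous_sqrt.continuousOn fun q hq => Real.sqrt_pos.2 hq

/-- There is an ideal tuning parameter. -/
lemma exists_isGreatest_blockExponent (hρ : |ρ| < 1) (η : ℝ) (hϑ : 0 < ϑ) (r : ℝ) :
    ∃ q ∈ Set.Ioi (0 : ℝ), ∀ q' ∈ Set.Ioi (0 : ℝ),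
      blockExponent ρ η q' ϑ r ≤ blockExponent ρ η q ϑ r := by
  -- The search is confined to `[ϑ, max r ϑ]`: below it the exponent is at most `q < ϑ`, above it at
  -- most `ϑ`, and `ϑ` is attained at the right endpoint.
  have hle : ϑ ≤ max r ϑ := le_max_right _ _
  obtain ⟨q, hq, hmax⟩ := isCompact_Icc.exists_isMaxOn (Set.nonempty_Icc.2 hle)
    ((continuousOn_blockExponent ρ η ϑ r).mono fun q hq => hϑ.trans_le hq.1)
  have hϑq : ϑ ≤ blockExponent ρ η q ϑ r := by
    have h := hmax (Set.right_mem_Icc.2 hle)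
    simp only [Set.mem_ofPred_eq] at h
    rwa [blockExponent_eq_of_le hρ hϑ (le_max_left _ _) hle] at h
  refine ⟨q, hϑ.trans_le hq.1, fun q' hq' => ?_⟩
  by_cases h1 : q' < ϑ
  · exact ((blockExponent_le_tuning hρ hq').trans h1.le).trans hϑq
  · by_cases h2 : q' ≤ max r ϑ
    · exact hmax ⟨not_lt.1 h1, h2⟩
    · exact (blockExponent_le_of_le hρ ((le_max_left _ _).trans (not_le.1 h2).le)).trans hϑq

/-- The Hamming exponent for an ideal tuning parameter. -/
def idealExponent (ρ η ϑ r : ℝ) : ℝ :=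
  sSup ((fun q => blockExponent ρ η q ϑ r) '' Set.Ioi 0)

lemma isGreatest_idealExponent (hρ : |ρ| < 1) (η : ℝ) (hϑ : 0 < ϑ) (r : ℝ) :
    IsGreatest ((fun q => blockExponent ρ η q ϑ r) '' Set.Ioi 0) (idealExponent ρ η ϑ r) := by
  obtain ⟨q, hq, hmax⟩ := exists_isGreatest_blockExponent hρ η hϑ r
  have h : IsGreatest ((fun q => blockExponent ρ η q ϑ r) '' Set.Ioi 0)
      (blockExponent ρ η q ϑ r) := by
    refine ⟨⟨q, hq, rfl⟩, ?_⟩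
    rintro _ ⟨q', hq', rfl⟩
    exact hmax q' hq'
  rwa [idealExponent, h.csSup_eq]

lemma lt_idealExponent_iff (hρ : |ρ| < 1) (hϑ : 0 < ϑ) (c : ℝ) :
    c < idealExponent ρ η ϑ r ↔ ∃ q, 0 < q ∧ c < blockExponent ρ η q ϑ r := by
  have h := isGreatest_idealExponent hρ η hϑ r
  constructor
  · intro hc
    obtain ⟨q, hq, hq'⟩ := h.1
    exact ⟨q, hq, by simp only at hq'; rwa [hq']⟩
  · rintro ⟨q, hq, hc⟩
    exact hc.trans_le (h.2 ⟨q, hq, rfl⟩)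

/-! ### The lower phase curve -/

/-- The case `c = ⊤`, in which `S` is empty, is included; it is needed when `h₄` is infinite. -/
lemma sInf_image_coe_eq {S : Set ℝ} {c : EReal} (hc : 0 ≤ c)
    (hS : ∀ r : ℝ, r ∈ S ↔ 0 < r ∧ c < r) : sInf ((fun r : ℝ => (r : EReal)) '' S) = c := by
  apply le_antisymm
  · by_contra hlt
    obtain ⟨x, hx1, hx2⟩ := EReal.lt_iff_exists_real_btwn.1 (not_le.1 hlt)
    have hx0 : 0 < x := by exact_mod_cast hc.trans_lt hx1
    exact absurd (sInf_le (Set.mem_image_of_mem _ ((hS x).2 ⟨hx0, hx1⟩))) (not_le.2 hx2)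
  · refine le_sInf ?_
    rintro _ ⟨r, hr, rfl⟩
    exact ((hS r).1 hr).2.le

/-- An exponent above `ϑ` forces `ϑ < q < r`. Conversely, besides `q > ϑ`, only two distances have
to be positive, because the two-signal term is at least `2ϑ > ϑ`. -/
lemma lowerPhaseCurve_idealExponent (hρ : |ρ| < 1) (hη : |η| ≤ |ρ|) (hρη : 0 ≤ ρ * η)
    (hϑ : 0 < ϑ) : lowerPhaseCurve (idealExponent ρ η) ϑ = ϑ := by
  refine sInf_image_coe_eq (by exact_mod_cast hϑ.le) fun r => ?_
  rw [Set.mem_ofPred_eq, lt_idealExponent_iff hρ hϑ, EReal.coe_lt_coe_iff]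
  refine and_congr_right fun hr => ⟨?_, fun hϑr => ?_⟩
  · rintro ⟨q, hq, hlt⟩
    by_contra hrϑ
    have hqϑ : ϑ < q := hlt.trans_le (blockExponent_le_tuning hρ hq)
    exact absurd (blockExponent_le_of_le (η := η) (ϑ := ϑ) hρ ((not_lt.1 hrϑ).trans hqϑ.le))
      (not_le.2 hlt)
  · have hR : 0 < √r := Real.sqrt_pos.2 hr
    have hη1 : |η| < 1 := hη.trans_lt hρ
    have hT : (|ρ| - |η|) / (1 - |η|) < 1 := by
      rw [div_lt_one (by linarith)]; linarith
    -- The second lower bound makes the bound of `le_fpDist` positive, and `s < √r` does the same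
    -- for `le_fnDist`.
    obtain ⟨s, hs1, hs2⟩ : ∃ s, max √ϑ ((|ρ| - |η|) / (1 - |η|) * √r) < s ∧ s < √r := by
      refine exists_between (max_lt (Real.sqrt_lt_sqrt hϑ.le hϑr) ?_)
      exact mul_lt_of_lt_one_left hR hT
    have hs0 : 0 < s := (Real.sqrt_nonneg _).trans_lt ((le_max_left _ _).trans_lt hs1)
    have hsq : √(s ^ 2) = s := Real.sqrt_sq hs0.le
    have hκ := contrastNorm_pos (η := η) hρ
    refine ⟨s ^ 2, by positivity, (lt_blockExponent_iff hρ (by positivity) _).2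
      ⟨?_, ?_, ?_, ?_⟩⟩
    · exact (Real.sqrt_lt' hs0).1 ((le_max_left _ _).trans_lt hs1)
    · have h1 : 0 < fpDist ρ η s √r := by
        refine lt_of_lt_of_le (div_pos ?_ hκ) (le_fpDist hρ hs0.le √r)
        have h2 := (le_max_right _ _).trans_lt hs1
        rw [div_mul_eq_mul_div, div_lt_iff₀ (by linarith)] at h2
        have h3 : |ρ - η| = |ρ| - |η| := by
          obtain ⟨σ, hσ1, -, h4, h5⟩ := exists_common_sign hη hρη
          conv_lhs => rw [h4, h5, ← mul_sub, abs_mul, hσ1, one_mul, abs_of_nonneg (sub_nonneg.2 hη)]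
        rw [abs_mul, abs_of_pos hR, h3]
        linarith
      rw [hsq]
      have := pow_pos h1 2
      linarith
    · have h1 : 0 < fnDist ρ η s √r 0 := by
        refine lt_of_lt_of_le (lt_min (by linarith) (div_pos ?_ hκ)) (le_fnDist hρ hs0.le √r 0)
        have h2 : ρ * η ≤ |η| := by
          calc ρ * η ≤ |ρ * η| := le_abs_self _
            _ = |ρ| * |η| := abs_mul _ _
            _ ≤ |η| := mul_le_of_le_one_left (abs_nonneg _) hρ.le
        nlinarith
      rw [hsq]
      have := pow_pos h1 2
      linarith
    · have := sq_nonneg (fnDist ρ η √(s ^ 2) √r √r)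
      linarith

/-! ### The upper phase curve -/

lemma coe_h₁_lt_iff {R : ℝ} (hR : 0 < R) :
    (h₁ ϑ : EReal) < (R ^ 2 : ℝ) ↔ 1 + √(1 - ϑ) < R := by
  rw [EReal.coe_lt_coe_iff, h₁, pow_lt_pow_iff_left₀ (by positivity) hR.le two_ne_zero]

lemma coe_h₂_lt_iff (hρ : |ρ| < 1) (hη : |η| ≤ |ρ|) (hϑ1 : ϑ < 1) {R : ℝ} (hR : 0 < R) :
    (h₂ ρ η ϑ : EReal) < (R ^ 2 : ℝ) ↔
      (1 - |η| + contrastNorm ρ η) * √(1 - ϑ) < (1 - |ρ|) * R := by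
  have h1 : 0 < 1 - |ρ| := by linarith
  have h2 : 0 < 1 - |η| := by linarith
  rw [EReal.coe_lt_coe_iff, h₂, ← contrastNorm, ← add_div]
  nth_rw 1 [← Real.sq_sqrt (show 0 ≤ 1 - ϑ by linarith)]
  have hκ := contrastNorm_pos (η := η) hρ
  rw [← mul_pow, pow_lt_pow_iff_left₀ (by positivity) hR.le two_ne_zero, div_mul_eq_mul_div,
    div_lt_iff₀ h1, mul_comm R]

lemma coe_h₃_lt_iff (hρ : |ρ| < 1) {R : ℝ} (hR : 0 < R) :
    (h₃ ρ η ϑ : EReal) < (R ^ 2 : ℝ) ↔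
      1 + contrastNorm ρ η / (1 + |η|) * √(1 - 2 * ϑ) < (1 - |ρ|) * R := by
  have h1 : 0 < 1 - |ρ| := by linarith
  have hκ := contrastNorm_pos (η := η) hρ
  rw [EReal.coe_lt_coe_iff, h₃, ← contrastNorm, one_div, ← inv_pow, ← mul_pow,
    pow_lt_pow_iff_left₀ (by positivity) hR.le two_ne_zero, inv_mul_lt_iff₀ h1]

lemma h₄_lt_iff (hρ : |ρ| < 1) (hη : |η| ≤ |ρ|) (hϑ1 : ϑ < 1) {R : ℝ} (hR : 0 < R) :
    h₄ ρ η ϑ < (R ^ 2 : ℝ) ↔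
      contrastNorm ρ η * (√(1 - ϑ) + (1 - |η|) / (1 + |η|) * √(1 - 2 * ϑ)) <
        (1 - 2 * |ρ| + ρ * η) * R := by
  have hκ := contrastNorm_pos (η := η) hρ
  have hw : 0 < √(1 - ϑ) := Real.sqrt_pos.2 (by linarith)
  have h2 : 0 < 1 - |η| := by linarith
  have h3 : 0 ≤ (1 - |η|) / (1 + |η|) * √(1 - 2 * ϑ) := by positivity
  unfold h₄
  split_ifs with h
  · rw [EReal.coe_lt_coe_iff, ← contrastNorm_sq hρ, ← div_pow, ← mul_pow,
      pow_lt_pow_iff_left₀ (by positivity) hR.le two_ne_zero, div_mul_eq_mul_div, div_lt_iff₀ h,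
      mul_comm R]
  -- Here both sides are false: the right side would put a nonnegative number below a nonpositive
  -- one.
  · simp only [not_top_lt, false_iff, not_lt]
    refine le_trans (mul_nonpos_of_nonpos_of_nonneg (not_lt.1 h) hR.le) ?_
    positivity

lemma one_lt_add_sq_iff {x c : ℝ} (hx : 0 ≤ x) (hc : c ≤ 1) : 1 < c + x ^ 2 ↔ √(1 - c) < x := by
  rw [← sub_lt_iff_lt_add', ← Real.sqrt_lt_sqrt_iff (sub_nonneg.2 hc), Real.sqrt_sq hx]

/-- Combines `κ ≤ 1`, `1 - 2a + ae ≤ (1 - e)²` and `1 - e ≤ 1 - ae`. It shows that two signals with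
`ρ ≥ 0` add no constraint. -/
lemma contrast_mul_le {a e κ : ℝ} (he : 0 ≤ e) (hea : e ≤ a) (ha : a < 1) (hκ : 0 < κ)
    (hκ2 : κ ^ 2 = 1 + e ^ 2 - 2 * a * e) : κ * (1 - 2 * a + a * e) ≤ (1 - e) * (1 - a * e) := by
  have h0 : e ^ 2 ≤ a * e := by nlinarith
  have h1 : κ ≤ 1 := by
    by_contra h
    push Not at h
    nlinarith
  have h2 : 1 - 2 * a + a * e ≤ (1 - e) ^ 2 := by nlinarith
  calc κ * (1 - 2 * a + a * e) ≤ κ * (1 - e) ^ 2 := mul_le_mul_of_nonneg_left h2 hκ.le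
    _ ≤ 1 * (1 - e) ^ 2 := mul_le_mul_of_nonneg_right h1 (sq_nonneg _)
    _ = (1 - e) * (1 - e) := by ring
    _ ≤ (1 - e) * (1 - a * e) :=
        mul_le_mul_of_nonneg_left (by nlinarith) (by linarith)

/-- The conditions under which all errors of the block have exponents above `1`. -/
lemma exists_one_lt_blockExponent_iff (hρ : |ρ| < 1) (hη : |η| ≤ |ρ|) (hρη : 0 ≤ ρ * η)
    (hϑ : 0 < ϑ) (hϑ1 : ϑ < 1) {R : ℝ} (hR : 0 < R) :
    (∃ q, 0 < q ∧ 1 < blockExponent ρ η q ϑ (R ^ 2)) ↔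
      ∃ s, 1 < s ∧ s < R - √(1 - ϑ) ∧
        (|ρ| - |η|) * R + contrastNorm ρ η * √(1 - ϑ) < (1 - |η|) * s ∧
        (ρ < 0 ∧ ϑ ≤ 1 / 2 →
          contrastNorm ρ η * √(1 - 2 * ϑ) < (1 + |η|) * ((1 - |ρ|) * R - s)) := by
  have hκ := contrastNorm_pos (η := η) hρ
  have hκ2 := contrastNorm_sq (η := η) hρ
  have hw : 0 < √(1 - ϑ) := Real.sqrt_pos.2 (by linarith)
  have hw2 : 0 ≤ √(1 - 2 * ϑ) := Real.sqrt_nonneg _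
  have hae : ρ * η = |ρ| * |η| := by rw [← abs_mul, abs_of_nonneg hρη]
  have he0 := abs_nonneg η
  constructor
  · rintro ⟨q, hq, h⟩
    obtain ⟨h1, h2, h3, h4⟩ := (lt_blockExponent_iff hρ hq _).1 h
    rw [Real.sqrt_sq hR.le] at h2 h3 h4
    have hs : 1 < √q := by rwa [← Real.sqrt_one, Real.sqrt_lt_sqrt_iff zero_le_one]
    set s := √q
    rw [one_lt_add_sq_iff (fpDist_nonneg _ _ _ _) hϑ1.le] at h2
    rw [one_lt_add_sq_iff (fnDist_nonneg _ _ _ _ _) hϑ1.le] at h3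
    have h3' := h3.trans_le (fnDist_zero_le hρ (by linarith) hR.le)
    have h3'' : √(1 - ϑ) < R - s := (lt_max_iff.1 h3').resolve_left hw.not_gt
    refine ⟨s, hs, by linarith, ?_, fun hP => ?_⟩
    · have h2' := h2.trans_le (fpDist_le hρ hη hρη (by linarith) (by linarith))
      rw [lt_div_iff₀ hκ] at h2'
      have := (lt_max_iff.1 h2').resolve_left (mul_pos hw hκ).not_gt
      linarith
    · rw [one_lt_add_sq_iff (fnDist_nonneg _ _ _ _ _) (by linarith [hP.2])] at h4
      have h4' := h4.trans_le (fnDist_le_of_neg hρ hη hρη hP.1 (by linarith) hR.le)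
      rw [lt_div_iff₀ hκ, mul_comm] at h4'
      exact (lt_max_iff.1 h4').resolve_left (mul_nonneg hκ.le hw2).not_gt
  · rintro ⟨s, h1, h2, h3, h4⟩
    have hs0 : 0 < s := by linarith
    refine ⟨s ^ 2, by positivity, (lt_blockExponent_iff hρ (by positivity) _).2 ?_⟩
    rw [Real.sqrt_sq hs0.le, Real.sqrt_sq hR.le,
      one_lt_add_sq_iff (fpDist_nonneg _ _ _ _) hϑ1.le,
      one_lt_add_sq_iff (fnDist_nonneg _ _ _ _ _) hϑ1.le]
    set w := √(1 - ϑ)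
    set κ := contrastNorm ρ η
    have hκe : κ ≤ 1 + |η| := by
      have h : κ ^ 2 ≤ (1 + |η|) ^ 2 := by
        rw [hκ2, add_sq, sq_abs]
        nlinarith [mul_nonneg (abs_nonneg ρ) he0]
      exact (pow_le_pow_iff_left₀ hκ.le (by linarith) two_ne_zero).1 h
    -- Eliminating `s` from `h2` and `h3`; this is the condition of the curve `h₂`.
    have h5 : (κ + 1 - |η|) * w < (1 - |ρ|) * R := by nlinarith
    refine ⟨by nlinarith, ?_, ?_, ?_⟩
    · refine lt_of_lt_of_le ?_ (le_fpDist hρ hs0.le R)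
      have h6 : |ρ - η| = |ρ| - |η| := by
        obtain ⟨σ, hσ1, -, h7, h8⟩ := exists_common_sign hη hρη
        conv_lhs => rw [h7, h8, ← mul_sub, abs_mul, hσ1, one_mul, abs_of_nonneg (sub_nonneg.2 hη)]
      rw [lt_div_iff₀ hκ, abs_mul, h6, abs_of_pos hR]
      linarith
    -- The second half-plane is never the binding one: with `s < R - w` and `h5`, the claim reduces
    -- to `(1 - |η|) (1 + |η| - κ) w ≥ 0`.
    · refine lt_of_lt_of_le (lt_min (by linarith) ?_) (le_fnDist hρ hs0.le R 0)
      rw [lt_div_iff₀ hκ, mul_zero, add_zero, hae]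
      have h6 : |η| * ((κ + 1 - |η|) * w) ≤ |η| * ((1 - |ρ|) * R) :=
        mul_le_mul_of_nonneg_left h5.le he0
      have h7 : 0 ≤ (1 - |η|) * (1 + |η| - κ) * w :=
        mul_nonneg (mul_nonneg (by linarith) (by linarith)) hw.le
      have h8 : (1 - |η|) * s < (1 - |η|) * (R - w) :=
        mul_lt_mul_of_pos_left h2 (by linarith)
      linarith
    · by_cases hϑ2 : ϑ ≤ 1 / 2
      · rw [one_lt_add_sq_iff (fnDist_nonneg _ _ _ _ _) (by linarith)]
        rcases lt_or_ge ρ 0 with hρ0 | hρ0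
        · refine lt_of_lt_of_le ?_ (le_fnDist_of_neg hρ hρη hρ0 hs0.le R)
          rw [lt_div_iff₀ hκ, mul_comm]
          exact h4 ⟨hρ0, hϑ2⟩
        -- For `ρ ≥ 0` signals reinforce each other, and the distance exceeds even `√(1 - ϑ)` by the
        -- conditions already at hand.
        · have hww : √(1 - 2 * ϑ) ≤ w := Real.sqrt_le_sqrt (by linarith)
          refine lt_of_le_of_lt hww (lt_of_lt_of_le (lt_min ?_ ?_) (le_fnDist hρ hs0.le R R))
          · nlinarith
          · have hη0 : η = |η| := by
              rcases hρ0.eq_or_lt with h | h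
              · have : η = 0 := by simpa [← h] using hη
                simp [this]
              · exact (abs_of_nonneg (by by_contra h'; push Not at h'; nlinarith)).symm
            have hρ0' : ρ = |ρ| := (abs_of_nonneg hρ0).symm
            rw [lt_div_iff₀ hκ, hae]
            have h9 := contrast_mul_le he0 hη hρ hκ
              (by rw [hκ2, mul_assoc, hae, sq_abs]; ring)
            have h10 : (1 - |η|) * s < (1 - |η|) * (R - w) :=
              mul_lt_mul_of_pos_left h2 (by linarith)
            have h11 : κ * w ≤ (1 - |η|) * (w + |ρ| * R) := by
              have h12 : 0 < 1 - |ρ| := by linarith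
              refine le_of_mul_le_mul_left ?_ h12
              have h13 := mul_le_mul_of_nonneg_left h5.le
                (mul_nonneg (by linarith : 0 ≤ 1 - |η|) (abs_nonneg ρ))
              have h14 := mul_le_mul_of_nonneg_right h9 hw.le
              linarith
            have h15 : (1 - |ρ| * |η|) * R + (ρ - η) * R =
                (1 - |η|) * (R + |ρ| * R) := by
              conv_lhs => rw [hρ0', hη0]
              simp only [abs_abs]
              ring
            rw [h15]
            linarith
      -- Two signals in a block cost `2ϑ > 1` by themselves.
      · have := sq_nonneg (fnDist ρ η s R R)
        linarith

/-- The level in the middle of the conditions can be eliminated. -/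
lemma exists_level_iff {R w w₂ a e κ : ℝ} (he0 : 0 ≤ e) (he1 : e < 1) (P : Prop) :
    (∃ s, 1 < s ∧ s < R - w ∧ (a - e) * R + κ * w < (1 - e) * s ∧
        (P → κ * w₂ < (1 + e) * ((1 - a) * R - s))) ↔
      (1 + w < R ∧ (1 - e + κ) * w < (1 - a) * R) ∧
        (P → 1 + κ / (1 + e) * w₂ < (1 - a) * R ∧
          κ * (w + (1 - e) / (1 + e) * w₂) < (1 - 2 * a + a * e) * R) := by
  have h1e : 0 < 1 - e := by linarith
  have h1e' : 0 < 1 + e := by linarith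
  -- The level must lie above `1` and `T`, and below `R - w` and, under `P`, `V`. The comparisons `1
  -- < R - w`, `T < R - w`, `1 < V`, `T < V` correspond to `h₁`, `h₂`, `h₃`, `h₄`.
  set T := ((a - e) * R + κ * w) / (1 - e) with hT
  set V := (1 - a) * R - κ / (1 + e) * w₂ with hV
  have hTmul : (1 - e) * T = (a - e) * R + κ * w := by rw [hT]; field_simp
  have hVmul : (1 - e) * V = (1 - e) * (1 - a) * R - κ * ((1 - e) / (1 + e) * w₂) := by
    rw [hV]; ring
  have hTs : ∀ s, (a - e) * R + κ * w < (1 - e) * s ↔ T < s := fun s => by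
    rw [← hTmul, mul_lt_mul_iff_right₀ h1e]
  have hVs : ∀ s, κ * w₂ < (1 + e) * ((1 - a) * R - s) ↔ s < V := fun s => by
    rw [hV, ← div_lt_iff₀' h1e', lt_sub_comm, div_mul_eq_mul_div]
  have h1 : 1 + w < R ↔ 1 < R - w := lt_sub_iff_add_lt.symm
  have h2 : (1 - e + κ) * w < (1 - a) * R ↔ T < R - w := by
    rw [← hTs]
    constructor <;> intro h <;> linarith
  have h3 : 1 + κ / (1 + e) * w₂ < (1 - a) * R ↔ 1 < V := lt_sub_iff_add_lt.symm
  have h4 : κ * (w + (1 - e) / (1 + e) * w₂) < (1 - 2 * a + a * e) * R ↔ T < V := by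
    rw [← hTs, hVmul]
    constructor <;> intro h <;> linarith
  simp only [hTs, hVs]
  rw [h1, h2, h3, h4]
  constructor
  · rintro ⟨s, k1, k2, k3, k4⟩
    exact ⟨⟨k1.trans k2, k3.trans k2⟩, fun hP => ⟨k1.trans (k4 hP), k3.trans (k4 hP)⟩⟩
  · rintro ⟨⟨k1, k2⟩, k3⟩
    by_cases hP : P
    · obtain ⟨k4, k5⟩ := k3 hP
      obtain ⟨s, hs1, hs2⟩ := exists_between (max_lt (lt_min k1 k4) (lt_min k2 k5))
      exact ⟨s, (le_max_left _ _).trans_lt hs1, hs2.trans_le (min_le_left _ _),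
        (le_max_right _ _).trans_lt hs1, fun _ => hs2.trans_le (min_le_right _ _)⟩
    · obtain ⟨s, hs1, hs2⟩ := exists_between (max_lt k1 k2)
      exact ⟨s, (le_max_left _ _).trans_lt hs1, hs2, (le_max_right _ _).trans_lt hs1,
        fun h => absurd h hP⟩

lemma upperCurveFormula_lt_iff (hρ : |ρ| < 1) (hη : |η| ≤ |ρ|) (hρη : 0 ≤ ρ * η) (hϑ1 : ϑ < 1)
    {R : ℝ} (hR : 0 < R) :
    upperCurveFormula ρ η ϑ < (R ^ 2 : ℝ) ↔
      (1 + √(1 - ϑ) < R ∧ (1 - |η| + contrastNorm ρ η) * √(1 - ϑ) < (1 - |ρ|) * R) ∧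
        (ρ < 0 ∧ ϑ ≤ 1 / 2 →
          1 + contrastNorm ρ η / (1 + |η|) * √(1 - 2 * ϑ) < (1 - |ρ|) * R ∧
          contrastNorm ρ η * (√(1 - ϑ) + (1 - |η|) / (1 + |η|) * √(1 - 2 * ϑ)) <
            (1 - 2 * |ρ| + |ρ| * |η|) * R) := by
  have hae : |ρ| * |η| = ρ * η := by rw [← abs_mul, abs_of_nonneg hρη]
  rw [hae, ← coe_h₁_lt_iff hR, ← coe_h₂_lt_iff hρ hη hϑ1 hR, ← coe_h₃_lt_iff hρ hR,
    ← h₄_lt_iff hρ hη hϑ1 hR, ← max_lt_iff, ← max_lt_iff]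
  unfold upperCurveFormula
  split_ifs with h
  · rw [max_lt_iff]
    exact ⟨fun k => ⟨k.1, fun _ => k.2⟩, fun k => ⟨k.1, k.2 h⟩⟩
  · exact ⟨fun k => ⟨k, fun h' => absurd h' h⟩, fun k => k.1⟩

lemma upperPhaseCurve_idealExponent (hρ : |ρ| < 1) (hη : |η| ≤ |ρ|) (hρη : 0 ≤ ρ * η)
    (hϑ : 0 < ϑ) (hϑ1 : ϑ < 1) :
    upperPhaseCurve (idealExponent ρ η) ϑ = upperCurveFormula ρ η ϑ := by
  have h0 : (0 : EReal) ≤ upperCurveFormula ρ η ϑ := by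
    have h1 : (0 : EReal) ≤ h₁ ϑ := by
      rw [← EReal.coe_zero, EReal.coe_le_coe_iff]
      exact sq_nonneg _
    unfold upperCurveFormula
    split_ifs
    · exact h1.trans ((le_max_left _ _).trans (le_max_left _ _))
    · exact h1.trans (le_max_left _ _)
  refine sInf_image_coe_eq h0 fun r => ?_
  rw [Set.mem_ofPred_eq, lt_idealExponent_iff hρ hϑ]
  refine and_congr_right fun hr => ?_
  obtain ⟨R, hR, rfl⟩ : ∃ R, 0 < R ∧ R ^ 2 = r :=
    ⟨√r, Real.sqrt_pos.2 hr, Real.sq_sqrt hr.le⟩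
  rw [exists_one_lt_blockExponent_iff hρ hη hρη hϑ hϑ1 hR,
    exists_level_iff (abs_nonneg η) (hη.trans_lt hρ), upperCurveFormula_lt_iff hρ hη hρη hϑ1 hR]

end Exponent
/-! ### Polynomial rates up to multi-log terms -/

/-- `E_p ≤ C p^{a + ε}` eventually, for all `ε > 0`. -/
def UpperRate (E : ℕ → ℝ) (a : ℝ) : Prop :=
  ∀ ε : ℝ, 0 < ε → ∃ C : ℝ, 0 ≤ C ∧ ∀ᶠ p : ℕ in atTop, E p ≤ C * (p : ℝ) ^ (a + ε)

/-- `E_p ≥ c p^{a - ε}` eventually, for all `ε > 0`. -/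
def LowerRate (E : ℕ → ℝ) (a : ℝ) : Prop :=
  ∀ ε : ℝ, 0 < ε → ∃ c : ℝ, 0 < c ∧ ∀ᶠ p : ℕ in atTop, c * (p : ℝ) ^ (a - ε) ≤ E p

section Rates

variable {E F : ℕ → ℝ} {a b : ℝ}

lemma eventually_one_le_cast : ∀ᶠ p : ℕ in atTop, (1 : ℝ) ≤ p := by
  filter_upwards [eventually_ge_atTop 1] with p hp
  exact_mod_cast hp

lemma UpperRate.mono (h : UpperRate E a) (hab : a ≤ b) : UpperRate E b := by
  intro ε hε
  obtain ⟨C, hC, h⟩ := h ε hε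
  refine ⟨C, hC, ?_⟩
  filter_upwards [h, eventually_one_le_cast] with p h hp
  exact h.trans (mul_le_mul_of_nonneg_left (Real.rpow_le_rpow_of_exponent_le hp (by linarith)) hC)

lemma UpperRate.mono_left (h : UpperRate E a) (hF : ∀ᶠ p in atTop, F p ≤ E p) :
    UpperRate F a := by
  intro ε hε
  obtain ⟨C, hC, h⟩ := h ε hε
  exact ⟨C, hC, by filter_upwards [h, hF] with p h hF using hF.trans h⟩

lemma LowerRate.mono_left (h : LowerRate E a) (hF : ∀ᶠ p in atTop, E p ≤ F p) :
    LowerRate F a := by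
  intro ε hε
  obtain ⟨C, hC, h⟩ := h ε hε
  exact ⟨C, hC, by filter_upwards [h, hF] with p h hF using h.trans hF⟩

lemma UpperRate.add (hE : UpperRate E a) (hF : UpperRate F a) :
    UpperRate (fun p => E p + F p) a := by
  intro ε hε
  obtain ⟨C, hC, hE⟩ := hE ε hε
  obtain ⟨D, hD, hF⟩ := hF ε hε
  refine ⟨C + D, add_nonneg hC hD, ?_⟩
  filter_upwards [hE, hF] with p hE hF
  rw [add_mul]
  exact add_le_add hE hF

lemma UpperRate.rpow_mul (hE : UpperRate E a) (b : ℝ) :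
    UpperRate (fun p => (p : ℝ) ^ b * E p) (b + a) := by
  intro ε hε
  obtain ⟨C, hC, hE⟩ := hE ε hε
  refine ⟨C, hC, ?_⟩
  filter_upwards [hE, eventually_one_le_cast] with p hE hp
  have hp0 : (0 : ℝ) < p := by linarith
  rw [add_assoc, Real.rpow_add hp0, mul_left_comm]
  exact mul_le_mul_of_nonneg_left hE (by positivity)

lemma LowerRate.rpow_mul (hE : LowerRate E a) (b : ℝ) :
    LowerRate (fun p => (p : ℝ) ^ b * E p) (b + a) := by
  intro ε hε
  obtain ⟨C, hC, hE⟩ := hE ε hε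
  refine ⟨C, hC, ?_⟩
  filter_upwards [hE, eventually_one_le_cast] with p hE hp
  have hp0 : (0 : ℝ) < p := by linarith
  rw [add_sub_assoc, Real.rpow_add hp0, mul_left_comm]
  exact mul_le_mul_of_nonneg_left hE (by positivity)

lemma LowerRate.const_mul (hE : LowerRate E a) {k : ℝ} (hk : 0 < k) :
    LowerRate (fun p => k * E p) a := by
  intro ε hε
  obtain ⟨C, hC, hE⟩ := hE ε hε
  refine ⟨k * C, mul_pos hk hC, ?_⟩
  filter_upwards [hE] with p hE
  rw [mul_assoc]
  exact mul_le_mul_of_nonneg_left hE hk.le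

lemma LowerRate.of_forall_lt (h : ∀ a' < a, LowerRate E a') : LowerRate E a := by
  intro ε hε
  obtain ⟨c, hc, h⟩ := h (a - ε / 2) (by linarith) (ε / 2) (by linarith)
  exact ⟨c, hc, by rwa [sub_sub, add_halves] at h⟩

lemma hasPolyRate_of_rates (hU : UpperRate E a) (hL : LowerRate E a) : HasPolyRate E a := by
  refine ⟨fun p => E p * (p : ℝ) ^ (-a), fun ε hε => ⟨?_, ?_⟩, ?_⟩
  · obtain ⟨c, hc, hL⟩ := hL (ε / 2) (by linarith)
    have h1 : Tendsto (fun p : ℕ => c * (p : ℝ) ^ (ε / 2)) atTop atTop :=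
      ((tendsto_rpow_atTop (by linarith)).comp tendsto_natCast_atTop_atTop).const_mul_atTop hc
    refine tendsto_atTop_mono' _ ?_ h1
    filter_upwards [hL, eventually_one_le_cast] with p hL hp
    have hp0 : (0 : ℝ) < p := by linarith
    have h2 : c * (p : ℝ) ^ (ε / 2) = c * (p : ℝ) ^ (a - ε / 2) * (p : ℝ) ^ (-a) * (p : ℝ) ^ ε := by
      rw [mul_assoc, mul_assoc, ← Real.rpow_add hp0, ← Real.rpow_add hp0]
      ring_nf
    rw [h2]
    gcongr
  · obtain ⟨C, hC, hU⟩ := hU (ε / 2) (by linarith)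
    -- Used only for `E p ≥ 0`; any positive loss would serve.
    obtain ⟨c, hc, hL⟩ := hL 1 one_pos
    have h1 : Tendsto (fun p : ℕ => C * (p : ℝ) ^ (-(ε / 2))) atTop (𝓝 0) := by
      simpa using ((tendsto_rpow_neg_atTop (by linarith : 0 < ε / 2)).comp
        tendsto_natCast_atTop_atTop).const_mul C
    refine tendsto_of_tendsto_of_tendsto_of_le_of_le' tendsto_const_nhds h1 ?_ ?_
    · filter_upwards [hL] with p hL
      have : 0 ≤ E p := le_trans (by positivity) hL
      positivity
    · filter_upwards [hU, eventually_one_le_cast] with p hU hp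
      have hp0 : (0 : ℝ) < p := by linarith
      have h2 : C * (p : ℝ) ^ (-(ε / 2)) =
          C * (p : ℝ) ^ (a + ε / 2) * (p : ℝ) ^ (-a) * (p : ℝ) ^ (-ε) := by
        rw [mul_assoc, mul_assoc, ← Real.rpow_add hp0, ← Real.rpow_add hp0]
        ring_nf
      rw [h2]
      gcongr
  · filter_upwards [eventually_one_le_cast] with p hp
    have hp0 : (0 : ℝ) < p := by linarith
    rw [mul_assoc, ← Real.rpow_add hp0, neg_add_cancel, Real.rpow_zero, mul_one]

end Rates

/-! ### Gaussian probabilities on the logarithmic scale -/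

/-- The scale `√(2 log p)` of the signal strength and of the tuning parameter. -/
def logScale (p : ℕ) : ℝ := √(2 * Real.log p)

lemma logScale_nonneg (p : ℕ) : 0 ≤ logScale p := Real.sqrt_nonneg _

lemma logScale_pos {p : ℕ} (hp : 1 < p) : 0 < logScale p :=
  Real.sqrt_pos.2 (mul_pos two_pos (Real.log_pos (by exact_mod_cast hp)))

lemma signalStrength_eq (r : ℝ) (p : ℕ) :
    signalStrength r p = logScale p * √r := by
  rw [signalStrength, logScale, ← Real.sqrt_mul (by positivity)]
  ring_nf

lemma tuning_eq (q : ℝ) (p : ℕ) : tuning q p = logScale p * √q :=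
  signalStrength_eq q p

/-- This turns squared distances in units of `logScale p` into exponents of `p`. -/
lemma exp_neg_mul_logScale_sq {p : ℕ} (hp : (1 : ℝ) ≤ p) (x : ℝ) :
    Real.exp (-(x * logScale p ^ 2 / 2)) = (p : ℝ) ^ (-x) := by
  rw [logScale, Real.sq_sqrt (mul_nonneg zero_le_two (Real.log_nonneg hp)),
    Real.rpow_def_of_pos (by linarith)]
  ring_nf

lemma tendsto_logScale : Tendsto logScale atTop atTop :=
  Real.tendsto_sqrt_atTop.comp ((Real.tendsto_log_atTop.comp
    tendsto_natCast_atTop_atTop).const_mul_atTop two_pos)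

lemma integrable_exp_mul_sq_gaussianReal {θ : ℝ} (hθ : θ < 1) :
    Integrable (fun x => Real.exp (θ / 2 * x ^ 2)) (gaussianReal 0 1) := by
  rw [gaussianReal_of_var_ne_zero _ one_ne_zero,
    integrable_withDensity_iff (measurable_gaussianPDF _ _)
      (Eventually.of_forall fun x => gaussianPDF_lt_top)]
  have h := (integrable_exp_neg_mul_sq (show 0 < (1 - θ) / 2 by linarith)).const_mul
    (√(2 * Real.pi * (1 : NNReal)))⁻¹
  refine h.congr (Eventually.of_forall fun x => ?_)
  simp only [toReal_gaussianPDF, gaussianPDFReal]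
  rw [mul_left_comm, ← Real.exp_add]
  congr 2
  simp only [NNReal.coe_one]
  ring

lemma integrable_exp_mul_sq_prod {θ : ℝ} (hθ : θ < 1) :
    Integrable (fun z : ℝ × ℝ => Real.exp (θ / 2 * ‖(⟨z.1, z.2⟩ : ℂ)‖ ^ 2))
      ((gaussianReal 0 1).prod (gaussianReal 0 1)) := by
  have h := (integrable_exp_mul_sq_gaussianReal hθ).mul_prod (integrable_exp_mul_sq_gaussianReal hθ)
  refine h.congr (Eventually.of_forall fun z => ?_)
  simp only [← Real.exp_add, Complex.sq_norm, Complex.normSq_mk]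
  ring_nf

/-- Upper bounds of probabilities by Chernoff's method, for variables with Gaussian tails. -/
lemma upperRate_measureReal {Ω : Type*} [MeasurableSpace Ω] {ν : Measure Ω}
    [IsProbabilityMeasure ν] {f : Ω → ℝ}
    (hf : ∀ θ : ℝ, θ < 1 → Integrable (fun x => Real.exp (θ / 2 * f x ^ 2)) ν)
    {d : ℝ} (hd : 0 ≤ d) {A : ℕ → Set Ω} (hA : ∀ᶠ p in atTop, ∀ x ∈ A p, logScale p * d ≤ f x) :
    UpperRate (fun p => ν.real (A p)) (-d ^ 2) := by
  intro ε hε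
  have hden : 0 < d ^ 2 + 1 + ε := by positivity
  -- Any `θ ∈ [0, 1)` with `(1 - θ) d² ≤ ε` would do; at `θ = 1` the Gaussian moment diverges.
  set θ := 1 - ε / (d ^ 2 + 1 + ε) with hθ
  have hθ1 : θ < 1 := sub_lt_self _ (div_pos hε hden)
  have hθ0 : 0 ≤ θ := by
    rw [hθ, sub_nonneg, div_le_one hden]
    nlinarith [sq_nonneg d]
  have hθd : -(θ * d ^ 2) ≤ -d ^ 2 + ε := by
    have h1 : ε / (d ^ 2 + 1 + ε) * d ^ 2 ≤ ε := by
      rw [div_mul_eq_mul_div, div_le_iff₀ hden]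
      nlinarith
    rw [hθ]
    linarith
  refine ⟨∫ x, Real.exp (θ / 2 * f x ^ 2) ∂ν, integral_nonneg fun x => (Real.exp_pos _).le, ?_⟩
  filter_upwards [hA, eventually_one_le_cast] with p hA hp
  have hp0 : (0 : ℝ) < p := by linarith
  set v := Real.exp (θ * d ^ 2 * logScale p ^ 2 / 2) with hv
  have hsub : A p ⊆ {x | v ≤ Real.exp (θ / 2 * f x ^ 2)} := by
    intro x hx
    have h1 := hA x hx
    have h2 := pow_le_pow_left₀ (mul_nonneg (logScale_nonneg p) hd) h1 2
    rw [Set.mem_ofPred_eq, hv, Real.exp_le_exp]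
    nlinarith
  have h1 := mul_meas_ge_le_integral_of_nonneg
    (Eventually.of_forall fun x => (Real.exp_pos _).le) (hf θ hθ1) v
  have h2 : v * ν.real (A p) ≤ ∫ x, Real.exp (θ / 2 * f x ^ 2) ∂ν :=
    (mul_le_mul_of_nonneg_left (measureReal_mono hsub) (Real.exp_pos _).le).trans h1
  have h3 : v⁻¹ = (p : ℝ) ^ (-(θ * d ^ 2)) := by
    rw [hv, ← Real.exp_neg, exp_neg_mul_logScale_sq hp]
  calc ν.real (A p) ≤ (∫ x, Real.exp (θ / 2 * f x ^ 2) ∂ν) * v⁻¹ := by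
        rw [← div_eq_mul_inv, le_div_iff₀ (Real.exp_pos _), mul_comm]
        exact h2
    _ ≤ _ := by
        rw [h3]
        exact mul_le_mul_of_nonneg_left (Real.rpow_le_rpow_of_exponent_le hp hθd)
          (integral_nonneg fun x => (Real.exp_pos _).le)

/-- The interval has length at least `1`, and `|z| ≤ (|x| + δ) t` on it bounds the density from
below. -/
lemma le_gaussianReal_interval {x δ t : ℝ} (ht : 0 ≤ t) (htδ : 1 ≤ 2 * (t * δ)) :
    (√(2 * Real.pi))⁻¹ * Real.exp (-((|x| + δ) ^ 2 * t ^ 2 / 2)) ≤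
      (gaussianReal 0 1).real {z | |z - t * x| < t * δ} := by
  set k := (√(2 * Real.pi))⁻¹ * Real.exp (-((|x| + δ) ^ 2 * t ^ 2 / 2)) with hk
  have hk0 : 0 ≤ k := by positivity
  rw [Measure.real, ← ENNReal.ofReal_le_iff_le_toReal (measure_ne_top _ _),
    gaussianReal_apply _ one_ne_zero]
  have hset : {z : ℝ | |z - t * x| < t * δ} = Set.Ioo (t * x - t * δ) (t * x + t * δ) := by
    ext z
    rw [Set.mem_ofPred_eq, abs_lt, Set.mem_Ioo]
    constructor <;> rintro ⟨h1, h2⟩ <;> constructor <;> linarith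
  have hvol : 1 ≤ volume {z : ℝ | |z - t * x| < t * δ} := by
    rw [hset, Real.volume_Ioo, ENNReal.one_le_ofReal]
    linarith
  calc ENNReal.ofReal k ≤ ENNReal.ofReal k * volume {z : ℝ | |z - t * x| < t * δ} :=
        le_mul_of_one_le_right zero_le hvol
    _ = ∫⁻ _ in {z : ℝ | |z - t * x| < t * δ}, ENNReal.ofReal k := (setLIntegral_const _ _).symm
    _ ≤ ∫⁻ z in {z : ℝ | |z - t * x| < t * δ}, gaussianPDF 0 1 z := by
        refine setLIntegral_mono (measurable_gaussianPDF _ _) fun z hz => ?_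
        refine ENNReal.ofReal_le_ofReal ?_
        rw [hk, gaussianPDFReal]
        simp only [NNReal.coe_one, mul_one, sub_zero]
        refine mul_le_mul_of_nonneg_left (Real.exp_le_exp.2 ?_) (by positivity)
        have h1 : |z| ≤ (|x| + δ) * t := by
          have h2 : |z| ≤ |z - t * x| + |t * x| := by
            simpa using abs_add_le (z - t * x) (t * x)
          rw [abs_mul, abs_of_nonneg ht] at h2
          rw [Set.mem_ofPred_eq] at hz
          linarith
        have h3 := pow_le_pow_left₀ (abs_nonneg z) h1 2
        rw [sq_abs, mul_pow] at h3
        linarith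

/-- Lower bounds of probabilities by the density near a point. -/
lemma lowerRate_of_box {x y δ₀ : ℝ} (hδ₀ : 0 < δ₀) {A : ℕ → Set (ℝ × ℝ)}
    (hA : ∀ᶠ p in atTop, ∀ z : ℝ × ℝ, |z.1 - logScale p * x| < logScale p * δ₀ →
      |z.2 - logScale p * y| < logScale p * δ₀ → z ∈ A p) :
    LowerRate (fun p => ((gaussianReal 0 1).prod (gaussianReal 0 1)).real (A p))
      (-(x ^ 2 + y ^ 2)) := by
  intro ε hε
  obtain ⟨δ, hδ, hδ1, hδε⟩ : ∃ δ, 0 < δ ∧ δ ≤ δ₀ ∧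
      (|x| + δ) ^ 2 + (|y| + δ) ^ 2 < x ^ 2 + y ^ 2 + ε := by
    have h1 : Tendsto (fun δ : ℝ => (|x| + δ) ^ 2 + (|y| + δ) ^ 2) (𝓝[>] 0) (𝓝 (x ^ 2 + y ^ 2)) := by
      have h : Continuous fun δ : ℝ => (|x| + δ) ^ 2 + (|y| + δ) ^ 2 := by fun_prop
      simpa using (h.tendsto 0).mono_left nhdsWithin_le_nhds
    obtain ⟨δ, h2, h3⟩ := ((h1.eventually_lt_const (show x ^ 2 + y ^ 2 < x ^ 2 + y ^ 2 + ε by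
      linarith)).and (Ioo_mem_nhdsGT hδ₀)).exists
    exact ⟨δ, h3.1, h3.2.le, h2⟩
  refine ⟨(√(2 * Real.pi))⁻¹ * (√(2 * Real.pi))⁻¹, by positivity, ?_⟩
  filter_upwards [hA, eventually_one_le_cast,
    tendsto_logScale.eventually_ge_atTop (1 / (2 * δ))] with p hA hp ht
  have htδ : 1 ≤ 2 * (logScale p * δ) := by
    rw [div_le_iff₀ (by positivity)] at ht
    linarith
  set t := logScale p with htdef
  have ht0 : 0 ≤ t := logScale_nonneg p
  have hsub : {z : ℝ | |z - t * x| < t * δ} ×ˢ {z : ℝ | |z - t * y| < t * δ} ⊆ A p := by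
    rintro z ⟨h1, h2⟩
    have h3 : t * δ ≤ t * δ₀ := mul_le_mul_of_nonneg_left hδ1 ht0
    exact hA z (lt_of_lt_of_le h1 h3) (lt_of_lt_of_le h2 h3)
  refine le_trans ?_ (measureReal_mono hsub)
  rw [measureReal_prod_prod]
  refine le_trans ?_ (mul_le_mul (le_gaussianReal_interval ht0 htδ)
    (le_gaussianReal_interval ht0 htδ) (by positivity) measureReal_nonneg)
  rw [mul_mul_mul_comm, htdef, exp_neg_mul_logScale_sq hp, exp_neg_mul_logScale_sq hp,
    ← Real.rpow_add (by linarith)]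
  exact mul_le_mul_of_nonneg_left (Real.rpow_le_rpow_of_exponent_le hp (by linarith))
    (by positivity)

/-- A standard Gaussian pair, as a point of the plane, shifted by `m`. -/
def shiftedPoint (m : ℂ) (z : ℝ × ℝ) : ℂ := m + ⟨z.1, z.2⟩

section Plane

open scoped Pointwise

lemma upperRate_plane (m : ℂ) (S : Set ℂ) :
    UpperRate (fun p => ((gaussianReal 0 1).prod (gaussianReal 0 1)).real
      {z | shiftedPoint (logScale p • m) z ∈ logScale p • S}) (-Metric.infDist m S ^ 2) := by
  refine upperRate_measureReal (fun θ => integrable_exp_mul_sq_prod) Metric.infDist_nonneg ?_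
  filter_upwards with p z hz
  obtain ⟨w, hw, hwz⟩ := Set.mem_smul_set.1 hz
  have h1 : (⟨z.1, z.2⟩ : ℂ) = logScale p • (w - m) := by
    rw [smul_sub, hwz, shiftedPoint, add_sub_cancel_left]
  rw [h1, norm_smul, Real.norm_eq_abs, abs_of_nonneg (logScale_nonneg p), ← dist_eq_norm,
    dist_comm]
  exact mul_le_mul_of_nonneg_left (Metric.infDist_le_dist_of_mem hw) (logScale_nonneg p)

/-- `S` and `T` are equally far from `m`. A box around any point of the open set `T` gives the
exponent of that point, and points nearly closest to `m` give the infimum. -/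
lemma lowerRate_plane {m : ℂ} {S T : Set ℂ} (hT : IsOpen T) (hTne : T.Nonempty) (hTS : T ⊆ S)
    (hST : S ⊆ closure T) :
    LowerRate (fun p => ((gaussianReal 0 1).prod (gaussianReal 0 1)).real
      {z | shiftedPoint (logScale p • m) z ∈ logScale p • S}) (-Metric.infDist m S ^ 2) := by
  have hinf : Metric.infDist m S = Metric.infDist m T := by
    refine le_antisymm (Metric.infDist_le_infDist_of_subset hTS hTne) ?_
    rw [← Metric.infDist_closure]
    exact Metric.infDist_le_infDist_of_subset hST (hTne.mono hTS)
  have hpt : ∀ w ∈ T, LowerRate (fun p => ((gaussianReal 0 1).prod (gaussianReal 0 1)).real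
      {z | shiftedPoint (logScale p • m) z ∈ logScale p • S}) (-dist m w ^ 2) := by
    intro w hw
    obtain ⟨δ, hδ, hball⟩ := Metric.isOpen_iff.1 hT w hw
    have h1 : dist m w ^ 2 = (w - m).re ^ 2 + (w - m).im ^ 2 := by
      rw [dist_comm, dist_eq_norm, Complex.sq_norm, Complex.normSq_apply]; ring
    rw [h1]
    refine lowerRate_of_box (half_pos hδ) ?_
    filter_upwards [eventually_gt_atTop 1] with p hp z hz1 hz2
    have ht := logScale_pos hp
    rw [Set.mem_smul_set_iff_inv_smul_mem₀ ht.ne']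
    refine hTS (hball ?_)
    rw [Metric.mem_ball, dist_eq_norm]
    set t := logScale p
    have h2 : t⁻¹ • shiftedPoint (t • m) z - w =
        t⁻¹ • (⟨z.1 - t * (w - m).re, z.2 - t * (w - m).im⟩ : ℂ) := by
      have h3 : (⟨z.1 - t * (w - m).re, z.2 - t * (w - m).im⟩ : ℂ) =
          shiftedPoint (t • m) z - t • w := by
        apply Complex.ext <;>
          simp only [shiftedPoint, Complex.sub_re, Complex.sub_im, Complex.add_re, Complex.add_im,
            Complex.smul_re, Complex.smul_im, smul_eq_mul] <;> ring
      rw [h3, smul_sub, inv_smul_smul₀ ht.ne']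
    rw [h2, norm_smul, norm_inv, Real.norm_eq_abs, abs_of_pos ht, inv_mul_lt_iff₀ ht]
    refine (Complex.norm_le_abs_re_add_abs_im _).trans_lt ?_
    simp only
    linarith
  rw [hinf]
  refine LowerRate.of_forall_lt fun a' ha' => ?_
  have h1 : Metric.infDist m T < √(-a') := by
    refine Real.lt_sqrt_of_sq_lt ?_
    linarith
  obtain ⟨w, hw, hmw⟩ := (Metric.infDist_lt_iff hTne).1 h1
  have h2 : a' ≤ -dist m w ^ 2 := by
    have := Real.lt_sqrt (y := -a') (dist_nonneg (x := m) (y := w)) |>.1 hmw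
    linarith
  intro ε hε
  obtain ⟨c, hc, h⟩ := hpt w hw ε hε
  refine ⟨c, hc, ?_⟩
  filter_upwards [h, eventually_one_le_cast] with p h hp
  exact (mul_le_mul_of_nonneg_left
    (Real.rpow_le_rpow_of_exponent_le hp (by linarith)) hc.le).trans h

end Plane

/-! ### Error probabilities of a block -/

/-- The probability of selecting a null variable when the other signal of the block is `b`. -/
def fpProb (ρ η lam b : ℝ) : ℝ :=
  ((gaussianReal 0 1).prod (gaussianReal 0 1)).real
    {z | shiftedPoint (center ρ 0 b) z ∈ selected ρ η lam}

/-- The probability of missing a signal `τ` when the other signal of the block is `b`. -/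
def fnProb (ρ η lam τ b : ℝ) : ℝ :=
  ((gaussianReal 0 1).prod (gaussianReal 0 1)).real
    {z | shiftedPoint (center ρ τ b) z ∈ (selected ρ η lam)ᶜ}

/-- The probability of an error at an index in a block of two, for signals `τ` of
probability `ε`. -/
def pairError (ρ η lam ε τ : ℝ) : ℝ :=
  (1 - ε) * ((1 - ε) * fpProb ρ η lam 0 + ε * fpProb ρ η lam τ) +
    ε * ((1 - ε) * fnProb ρ η lam τ 0 + ε * fnProb ρ η lam τ τ)

/-- The probability of an error at an index in a block of one. -/
def singleError (lam ε τ : ℝ) : ℝ :=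
  (1 - ε) * (gaussianReal 0 1).real {x | lam < |x|} +
    ε * (gaussianReal 0 1).real {x | |τ + x| ≤ lam}

lemma fpProb_nonneg (ρ η lam b : ℝ) : 0 ≤ fpProb ρ η lam b := measureReal_nonneg

lemma fnProb_nonneg (ρ η lam τ b : ℝ) : 0 ≤ fnProb ρ η lam τ b := measureReal_nonneg

section ErrorRates

open scoped Pointwise

variable {ρ η : ℝ}

lemma fpProb_logScale {p : ℕ} (hp : 1 < p) (ρ η s b : ℝ) :
    fpProb ρ η (logScale p * s) (logScale p * b) =
      ((gaussianReal 0 1).prod (gaussianReal 0 1)).real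
        {z | shiftedPoint (logScale p • center ρ 0 b) z ∈ logScale p • selected ρ η s} := by
  rw [fpProb, smul_selected (logScale_pos hp), ← center_mul, mul_zero]

lemma fnProb_logScale {p : ℕ} (hp : 1 < p) (ρ η s R b : ℝ) :
    fnProb ρ η (logScale p * s) (logScale p * R) (logScale p * b) =
      ((gaussianReal 0 1).prod (gaussianReal 0 1)).real
        {z | shiftedPoint (logScale p • center ρ R b) z ∈ logScale p • (selected ρ η s)ᶜ} := by
  rw [fnProb, smul_compl_selected (logScale_pos hp), ← center_mul]

lemma upperRate_fpProb (ρ η s b : ℝ) :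
    UpperRate (fun p => fpProb ρ η (logScale p * s) (logScale p * b)) (-fpDist ρ η s b ^ 2) := by
  refine (upperRate_plane _ _).mono_left ?_
  filter_upwards [eventually_gt_atTop 1] with p hp using (fpProb_logScale hp ρ η s b).le

lemma upperRate_fnProb (ρ η s R b : ℝ) :
    UpperRate (fun p => fnProb ρ η (logScale p * s) (logScale p * R) (logScale p * b))
      (-fnDist ρ η s R b ^ 2) := by
  refine (upperRate_plane _ _).mono_left ?_
  filter_upwards [eventually_gt_atTop 1] with p hp using (fnProb_logScale hp ρ η s R b).le

lemma lowerRate_fpProb (hρ : |ρ| < 1) (η b : ℝ) {s : ℝ} (hs : 0 < s) :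
    LowerRate (fun p => fpProb ρ η (logScale p * s) (logScale p * b)) (-fpDist ρ η s b ^ 2) := by
  refine (lowerRate_plane (isOpen_selected ρ η s) (selected_nonempty hρ hs.le) subset_rfl
    subset_closure).mono_left ?_
  filter_upwards [eventually_gt_atTop 1] with p hp using (fpProb_logScale hp ρ η s b).ge

lemma lowerRate_fnProb (hρ : |ρ| < 1) (η R b : ℝ) {s : ℝ} (hs : 0 < s) :
    LowerRate (fun p => fnProb ρ η (logScale p * s) (logScale p * R) (logScale p * b))
      (-fnDist ρ η s R b ^ 2) := by
  have hopen : IsOpen {w : ℂ | |w.re - η * softThreshold s (sndCoord ρ w)| < s} :=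
    isOpen_lt (Complex.continuous_re.sub (continuous_const.mul
      ((continuous_softThreshold s).comp (continuous_sndCoord ρ)))).abs continuous_const
  have hne : {w : ℂ | |w.re - η * softThreshold s (sndCoord ρ w)| < s}.Nonempty :=
    closure_nonempty_iff.1 ((Set.nonempty_of_mem (zero_mem_compl_selected hs.le)).mono
      (compl_selected_subset_closure hρ hs))
  refine (lowerRate_plane hopen hne (fun w hw => ?_)
    (compl_selected_subset_closure hρ hs)).mono_left ?_
  · simp only [selected, Set.mem_compl_iff, Set.mem_ofPred_eq, not_lt]
    exact le_of_lt hw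
  · filter_upwards [eventually_gt_atTop 1] with p hp using (fnProb_logScale hp ρ η s R b).ge

end ErrorRates

lemma sparsity_pos {p : ℕ} (hp : 0 < p) (ϑ : ℝ) : 0 < sparsity ϑ p :=
  Real.rpow_pos_of_pos (by exact_mod_cast hp) _

lemma sparsity_le_one {p : ℕ} (hp : 0 < p) {ϑ : ℝ} (hϑ : 0 < ϑ) : sparsity ϑ p ≤ 1 :=
  Real.rpow_le_one_of_one_le_of_nonpos (by exact_mod_cast hp) (by linarith)

section PairRates

variable {ρ η q ϑ r : ℝ}

lemma upperRate_pairError (ρ η q : ℝ) (hϑ : 0 < ϑ) (r : ℝ) :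
    UpperRate (fun p => pairError ρ η (tuning q p) (sparsity ϑ p) (signalStrength r p))
      (-blockExponent ρ η q ϑ r) := by
  have h1 := upperRate_fpProb ρ η √q 0
  have h2 := (upperRate_fpProb ρ η √q √r).rpow_mul (-ϑ)
  have h3 := (upperRate_fnProb ρ η √q √r 0).rpow_mul (-ϑ)
  have h4 := (upperRate_fnProb ρ η √q √r √r).rpow_mul (-(2 * ϑ))
  have k : ∀ {x}, blockExponent ρ η q ϑ r ≤ x → -x ≤ -blockExponent ρ η q ϑ r := neg_le_neg
  refine (((h1.mono (k ((min_le_left _ _).trans (min_le_left _ _)))).add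
    (h2.mono ?_)).add ((h3.mono ?_).add (h4.mono ?_))).mono_left ?_
  · rw [← neg_add]; exact k ((min_le_left _ _).trans (min_le_right _ _))
  · rw [← neg_add]; exact k ((min_le_right _ _).trans (min_le_left _ _))
  · rw [← neg_add]; exact k ((min_le_right _ _).trans (min_le_right _ _))
  · filter_upwards [eventually_gt_atTop 0] with p hp
    have hp' : (0 : ℝ) < p := by exact_mod_cast hp
    have hε0 := (sparsity_pos hp ϑ).le
    have hε1 := sparsity_le_one hp hϑ
    have hε2 : (p : ℝ) ^ (-(2 * ϑ)) = sparsity ϑ p * sparsity ϑ p := by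
      rw [sparsity, ← Real.rpow_add hp']; ring_nf
    rw [hε2, tuning_eq, signalStrength_eq, mul_zero]
    change _ ≤ _ + sparsity ϑ p * _ + (sparsity ϑ p * _ + _)
    set ε := sparsity ϑ p
    set t := logScale p
    unfold pairError
    have e1 := fpProb_nonneg ρ η (t * √q) 0
    have e2 := fpProb_nonneg ρ η (t * √q) (t * √r)
    have e3 := fnProb_nonneg ρ η (t * √q) (t * √r) 0
    have c1 : (1 - ε) * (1 - ε) ≤ 1 := by nlinarith
    have c2 : (1 - ε) * ε ≤ ε := by nlinarith
    have m1 := mul_le_mul_of_nonneg_right c1 e1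
    have m2 := mul_le_mul_of_nonneg_right c2 e2
    have m3 := mul_le_mul_of_nonneg_right c2 e3
    linarith

/-- Each of the four error terms alone bounds the total from below, up to a constant once the
sparsity is below `1/2`; the minimum of the exponents is attained by one of them. -/
lemma lowerRate_pairError (hρ : |ρ| < 1) (η r : ℝ) (hq : 0 < q) (hϑ : 0 < ϑ) :
    LowerRate (fun p => pairError ρ η (tuning q p) (sparsity ϑ p) (signalStrength r p))
      (-blockExponent ρ η q ϑ r) := by
  have hs : 0 < √q := Real.sqrt_pos.2 hq
  have h1 := (lowerRate_fpProb hρ η 0 hs).const_mul (show (0 : ℝ) < 1 / 4 by norm_num)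
  have h2 := ((lowerRate_fpProb hρ η √r hs).rpow_mul (-ϑ)).const_mul
    (show (0 : ℝ) < 1 / 2 by norm_num)
  have h3 := ((lowerRate_fnProb hρ η √r 0 hs).rpow_mul (-ϑ)).const_mul
    (show (0 : ℝ) < 1 / 2 by norm_num)
  have h4 := (lowerRate_fnProb hρ η √r √r hs).rpow_mul (-(2 * ϑ))
  have hhalf : ∀ᶠ p : ℕ in atTop, sparsity ϑ p < 1 / 2 :=
    ((tendsto_rpow_neg_atTop hϑ).comp tendsto_natCast_atTop_atTop).eventually_lt_const
      (by norm_num)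
  have key : ∀ᶠ p : ℕ in atTop,
      1 / 4 * fpProb ρ η (logScale p * √q) (logScale p * 0) ≤
          pairError ρ η (tuning q p) (sparsity ϑ p) (signalStrength r p) ∧
      1 / 2 * ((p : ℝ) ^ (-ϑ) * fpProb ρ η (logScale p * √q) (logScale p * √r)) ≤
          pairError ρ η (tuning q p) (sparsity ϑ p) (signalStrength r p) ∧
      1 / 2 * ((p : ℝ) ^ (-ϑ) *
        fnProb ρ η (logScale p * √q) (logScale p * √r) (logScale p * 0)) ≤
          pairError ρ η (tuning q p) (sparsity ϑ p) (signalStrength r p) ∧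
      (p : ℝ) ^ (-(2 * ϑ)) *
        fnProb ρ η (logScale p * √q) (logScale p * √r) (logScale p * √r) ≤
          pairError ρ η (tuning q p) (sparsity ϑ p) (signalStrength r p) := by
    filter_upwards [eventually_gt_atTop 0, hhalf] with p hp hε1
    have hp' : (0 : ℝ) < p := by exact_mod_cast hp
    have hε0 := sparsity_pos hp ϑ
    have hε2 : (p : ℝ) ^ (-(2 * ϑ)) = sparsity ϑ p * sparsity ϑ p := by
      rw [sparsity, ← Real.rpow_add hp']; ring_nf
    rw [hε2, tuning_eq, signalStrength_eq, mul_zero, show (p : ℝ) ^ (-ϑ) = sparsity ϑ p from rfl]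
    set ε := sparsity ϑ p
    set t := logScale p
    unfold pairError
    have e1 := fpProb_nonneg ρ η (t * √q) 0
    have e2 := fpProb_nonneg ρ η (t * √q) (t * √r)
    have e3 := fnProb_nonneg ρ η (t * √q) (t * √r) 0
    have e4 := fnProb_nonneg ρ η (t * √q) (t * √r) (t * √r)
    have c1 : 1 / 4 ≤ (1 - ε) * (1 - ε) := by nlinarith
    have c2 : 1 / 2 * ε ≤ (1 - ε) * ε := by nlinarith
    have m1 := mul_le_mul_of_nonneg_right c1 e1
    have m2 := mul_le_mul_of_nonneg_right c2 e2
    have m3 := mul_le_mul_of_nonneg_right c2 e3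
    have m4 := mul_nonneg (mul_nonneg hε0.le hε0.le) e4
    have n1 : 0 ≤ 1 / 4 * fpProb ρ η (t * √q) 0 := by positivity
    have n2 : 0 ≤ 1 / 2 * ε * fpProb ρ η (t * √q) (t * √r) := by positivity
    have n3 : 0 ≤ 1 / 2 * ε * fnProb ρ η (t * √q) (t * √r) 0 := by positivity
    refine ⟨?_, ?_, ?_, ?_⟩ <;> linarith
  have k1 := h1.mono_left (key.mono fun p h => h.1)
  have k2 := h2.mono_left (key.mono fun p h => h.2.1)
  have k3 := h3.mono_left (key.mono fun p h => h.2.2.1)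
  have k4 := h4.mono_left (key.mono fun p h => h.2.2.2)
  rw [← neg_add] at k2 k3 k4
  unfold blockExponent
  rcases min_choice (min (fpDist ρ η √q 0 ^ 2) (ϑ + fpDist ρ η √q √r ^ 2))
    (min (ϑ + fnDist ρ η √q √r 0 ^ 2) (2 * ϑ + fnDist ρ η √q √r √r ^ 2)) with h | h <;> rw [h]
  · rcases min_choice (fpDist ρ η √q 0 ^ 2) (ϑ + fpDist ρ η √q √r ^ 2) with h | h <;> rw [h]
    exacts [k1, k2]
  · rcases min_choice (ϑ + fnDist ρ η √q √r 0 ^ 2) (2 * ϑ + fnDist ρ η √q √r √r ^ 2) with h | h <;>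
      rw [h]
    exacts [k3, k4]

/-- A block of one has exponents `q` and `ϑ + (√r - √q)₊²`, both at least `blockExponent`, so the
unpaired index cannot dominate. -/
lemma upperRate_singleError (hρ : |ρ| < 1) (η ϑ r : ℝ) (hq : 0 < q) :
    UpperRate (fun p => singleError (tuning q p) (sparsity ϑ p) (signalStrength r p))
      (-blockExponent ρ η q ϑ r) := by
  have hf : ∀ θ : ℝ, θ < 1 → Integrable (fun x => Real.exp (θ / 2 * |x| ^ 2))
      (gaussianReal 0 1) := fun θ hθ => by
    simpa only [sq_abs] using integrable_exp_mul_sq_gaussianReal hθ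
  have h1 : UpperRate (fun p => (gaussianReal 0 1).real {x | tuning q p < |x|}) (-√q ^ 2) := by
    refine upperRate_measureReal hf (Real.sqrt_nonneg q) ?_
    filter_upwards with p x hx
    rw [← tuning_eq]
    exact le_of_lt hx
  have h2 : UpperRate (fun p => (gaussianReal 0 1).real {x | |signalStrength r p + x| ≤ tuning q p})
      (-(max 0 (√r - √q)) ^ 2) := by
    refine upperRate_measureReal hf (le_max_left _ _) ?_
    filter_upwards with p x hx
    have hx' : |signalStrength r p + x| ≤ tuning q p := hx
    rw [mul_max_of_nonneg _ _ (logScale_nonneg p), mul_zero, mul_sub, ← tuning_eq q,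
      ← signalStrength_eq r]
    refine max_le (abs_nonneg x) ?_
    have h3 := neg_abs_le x
    have h4 := le_abs_self (signalStrength r p + x)
    linarith
  have h3 := h2.rpow_mul (-ϑ)
  rw [← neg_add] at h3
  refine ((h1.mono ?_).add (h3.mono (neg_le_neg (blockExponent_le_single hρ q)))).mono_left ?_
  · rw [Real.sq_sqrt hq.le]
    exact neg_le_neg (blockExponent_le_tuning hρ hq)
  · filter_upwards [eventually_gt_atTop 0] with p hp
    exact add_le_add_left (mul_le_of_le_one_left measureReal_nonneg
      (by linarith [sparsity_pos hp ϑ])) _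

end PairRates

/-! ### Marginal laws -/

/-- The law of a single signal. -/
def coordLaw (ϑ r : ℝ) (p : ℕ) : Measure ℝ :=
  ENNReal.ofReal (sparsity ϑ p) • Measure.dirac (signalStrength r p) +
    ENNReal.ofReal (1 - sparsity ϑ p) • Measure.dirac 0

lemma isProbabilityMeasure_coordLaw {ϑ : ℝ} (hϑ : 0 < ϑ) (r : ℝ) {p : ℕ} (hp : 0 < p) :
    IsProbabilityMeasure (coordLaw ϑ r p) := by
  constructor
  simp only [coordLaw, Measure.coe_add, Measure.coe_smul, Pi.add_apply, Pi.smul_apply,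
    measure_univ, smul_eq_mul, mul_one]
  rw [← ENNReal.ofReal_add (sparsity_pos hp ϑ).le (by linarith [sparsity_le_one hp hϑ]),
    add_sub_cancel, ENNReal.ofReal_one]

lemma lintegral_coordLaw (ϑ r : ℝ) (p : ℕ) (f : ℝ → ENNReal) :
    ∫⁻ b, f b ∂coordLaw ϑ r p = ENNReal.ofReal (sparsity ϑ p) * f (signalStrength r p) +
      ENNReal.ofReal (1 - sparsity ϑ p) * f 0 := by
  rw [coordLaw, lintegral_add_measure, lintegral_smul_measure, lintegral_smul_measure,
    lintegral_dirac, lintegral_dirac, smul_eq_mul, smul_eq_mul]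

instance isProbabilityMeasure_noiseLaw (n : ℕ) : IsProbabilityMeasure (noiseLaw n) := by
  unfold noiseLaw; infer_instance

lemma isProbabilityMeasure_signalLaw {ϑ : ℝ} (hϑ : 0 < ϑ) (r : ℝ) {p : ℕ} (hp : 0 < p) :
    IsProbabilityMeasure (signalLaw ϑ r p) := by
  have := isProbabilityMeasure_coordLaw hϑ r hp
  change IsProbabilityMeasure (Measure.pi fun _ => coordLaw ϑ r p)
  infer_instance

lemma map_signalLaw_apply {ϑ : ℝ} (hϑ : 0 < ϑ) (r : ℝ) {p : ℕ} (j : Fin p) :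
    (signalLaw ϑ r p).map (fun b => b j) = coordLaw ϑ r p := by
  have := isProbabilityMeasure_coordLaw hϑ r j.pos
  exact (measurePreserving_eval (fun _ : Fin p => coordLaw ϑ r p) j).map_eq

lemma map_signalLaw_pair {ϑ : ℝ} (hϑ : 0 < ϑ) (r : ℝ) {p : ℕ} {j k : Fin p} (hjk : j ≠ k) :
    (signalLaw ϑ r p).map (fun b => (b j, b k)) = (coordLaw ϑ r p).prod (coordLaw ϑ r p) := by
  have := isProbabilityMeasure_coordLaw hϑ r j.pos
  have := isProbabilityMeasure_signalLaw hϑ r j.pos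
  have h : iIndepFun (fun (i : Fin p) (b : Fin p → ℝ) => b i) (signalLaw ϑ r p) :=
    iIndepFun_pi (μ := fun _ : Fin p => coordLaw ϑ r p) (X := fun _ x => x)
      fun _ => measurable_id.aemeasurable
  have h2 := (indepFun_iff_map_prod_eq_prod_map_map (measurable_pi_apply j).aemeasurable
    (measurable_pi_apply k).aemeasurable).1 (h.indepFun hjk)
  rwa [map_signalLaw_apply hϑ, map_signalLaw_apply hϑ] at h2

lemma integral_exp_noiseLaw {n : ℕ} (v : Fin n → ℝ) :
    ∫ z, Complex.exp ((v ⬝ᵥ z : ℝ) * Complex.I) ∂noiseLaw n =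
      Complex.exp (-((v ⬝ᵥ v : ℝ) : ℂ) / 2) := by
  have h := charFun_stdGaussian (WithLp.toLp 2 v : EuclideanSpace ℝ (Fin n))
  rw [← map_pi_eq_stdGaussian, charFun_apply, integral_map (by fun_prop) (by fun_prop)] at h
  have h1 : ∀ z, inner ℝ (WithLp.toLp 2 z : EuclideanSpace ℝ (Fin n)) (WithLp.toLp 2 v) =
      v ⬝ᵥ z := fun z => by
    simp [PiLp.inner_apply, dotProduct]
  have h2 : ‖(WithLp.toLp 2 v : EuclideanSpace ℝ (Fin n))‖ ^ 2 = v ⬝ᵥ v := by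
    rw [← h1, real_inner_self_eq_norm_sq]
  simp only [h1] at h
  rw [noiseLaw, h, ← h2]
  push_cast
  rfl

lemma measurable_dotProduct {n : ℕ} (u : Fin n → ℝ) : Measurable fun z : Fin n → ℝ => u ⬝ᵥ z := by
  unfold dotProduct
  fun_prop

lemma map_noiseLaw_dotProduct {n : ℕ} {u : Fin n → ℝ} (hu : u ⬝ᵥ u = 1) :
    (noiseLaw n).map (fun z => u ⬝ᵥ z) = gaussianReal 0 1 := by
  have hm := measurable_dotProduct u
  have := Measure.isProbabilityMeasure_map (μ := noiseLaw n) hm.aemeasurable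
  refine Measure.ext_of_charFun (funext fun t => ?_)
  rw [charFun_gaussianReal, charFun_apply_real, integral_map hm.aemeasurable (by fun_prop)]
  have h := integral_exp_noiseLaw (t • u)
  simp only [smul_dotProduct, dotProduct_smul, hu, smul_eq_mul] at h
  push_cast at h
  rw [h]
  congr 1
  simp only [Complex.ofReal_zero, NNReal.coe_one, Complex.ofReal_one]
  ring

/-- The characteristic function depends on `u` and `v` only through their inner products; hence the
design matters only through its Gram matrix. -/
lemma map_noiseLaw_pair {n : ℕ} {u v : Fin n → ℝ} (hu : u ⬝ᵥ u = 1) (hv : v ⬝ᵥ v = 1)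
    (huv : u ⬝ᵥ v = 0) :
    (noiseLaw n).map (fun z => (u ⬝ᵥ z, v ⬝ᵥ z)) =
      (gaussianReal 0 1).prod (gaussianReal 0 1) := by
  have hm : Measurable fun z : Fin n → ℝ => (u ⬝ᵥ z, v ⬝ᵥ z) :=
    (measurable_dotProduct u).prodMk (measurable_dotProduct v)
  have := Measure.isProbabilityMeasure_map (μ := noiseLaw n) hm.aemeasurable
  refine charFun_eq_prod_iff.1 fun t => ?_
  rw [charFun_apply, integral_map (by fun_prop) (by fun_prop),
    integral_map hm.aemeasurable (by fun_prop), charFun_gaussianReal, charFun_gaussianReal,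
    ← Complex.exp_add]
  have h1 : ∀ z : Fin n → ℝ, inner ℝ (WithLp.toLp 2 (u ⬝ᵥ z, v ⬝ᵥ z)) t =
      (t.ofLp.1 • u + t.ofLp.2 • v) ⬝ᵥ z := fun z => by
    simp [WithLp.prod_inner_apply, add_dotProduct, smul_dotProduct]
  have h2 : (t.ofLp.1 • u + t.ofLp.2 • v) ⬝ᵥ (t.ofLp.1 • u + t.ofLp.2 • v) =
      t.ofLp.1 ^ 2 + t.ofLp.2 ^ 2 := by
    simp only [add_dotProduct, dotProduct_add, smul_dotProduct, dotProduct_smul, hu, hv, huv,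
      dotProduct_comm v u, smul_eq_mul]
    ring
  simp only [h1]
  rw [integral_exp_noiseLaw, h2]
  congr 1
  simp only [Complex.ofReal_zero, NNReal.coe_one, Complex.ofReal_one]
  push_cast
  ring

/-! ### The expected Hamming error as a sum of error probabilities -/

/-- The event that `est` makes an error at the index `j`. -/
def errorEvent (est : TunedEstimator) {n p : ℕ} (X : Matrix (Fin n) (Fin p) ℝ) (lam : ℝ)
    (j : Fin p) : Set ((Fin p → ℝ) × (Fin n → ℝ)) :=
  {w | (est X lam (X *ᵥ w.1 + w.2) j ≠ 0 ∧ w.1 j = 0) ∨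
    (est X lam (X *ᵥ w.1 + w.2) j = 0 ∧ w.1 j ≠ 0)}

lemma expectedHamming_eq_sum (est : TunedEstimator) {n p : ℕ} (X : Matrix (Fin n) (Fin p) ℝ)
    (lam : ℝ) {ϑ : ℝ} (hϑ : 0 < ϑ) (r : ℝ) (hp : 0 < p)
    (hmeas : ∀ j, MeasurableSet (errorEvent est X lam j)) :
    expectedHamming est X lam ϑ r =
      ∑ j, ((signalLaw ϑ r p).prod (noiseLaw n)).real (errorEvent est X lam j) := by
  have := isProbabilityMeasure_signalLaw hϑ r hp
  have h : ∀ w : (Fin p → ℝ) × (Fin n → ℝ), hamming (est X lam (X *ᵥ w.1 + w.2)) w.1 =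
      ∑ j, (errorEvent est X lam j).indicator 1 w := by
    intro w
    rw [hamming, ← Finset.sum_add_distrib]
    refine Finset.sum_congr rfl fun j _ => ?_
    by_cases h1 : est X lam (X *ᵥ w.1 + w.2) j = 0 <;> by_cases h2 : w.1 j = 0 <;>
      simp [errorEvent, Set.indicator, h1, h2]
  have hint : ∀ j, Integrable ((errorEvent est X lam j).indicator (1 : (Fin p → ℝ) × (Fin n → ℝ) → ℝ))
      ((signalLaw ϑ r p).prod (noiseLaw n)) := fun j =>
    (integrable_const (1 : ℝ)).indicator (hmeas j)
  unfold expectedHamming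
  simp only [h]
  rw [integral_finsetSum _ fun j _ => hint j]
  exact Finset.sum_congr rfl fun j _ => integral_indicator_one (hmeas j)

section Net

variable {n p : ℕ} {ρ μ : ℝ} {X : Matrix (Fin n) (Fin p) ℝ} {lam : ℝ}

lemma transpose_mulVec_response (hX : Xᵀ * X = blockGram ρ p) (b : Fin p → ℝ) (z : Fin n → ℝ)
    (j : Fin p) :
    (Xᵀ *ᵥ (X *ᵥ b + z)) j = b j + ρ * ∑ k ∈ partners j, b k + X.col j ⬝ᵥ z := by
  rw [Matrix.mulVec_add, Matrix.mulVec_mulVec, hX, Pi.add_apply, blockGram_mulVec]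
  rfl

/-- The estimator is defined by choice; measurability comes from the explicit criterion for
selection. -/
lemma measurableSet_errorEvent_elasticNet (hρ : |ρ| < 1) (hμ : 0 ≤ μ)
    (hX : Xᵀ * X = blockGram ρ p) (hlam : 0 ≤ lam) (j : Fin p) :
    MeasurableSet (errorEvent (elasticNet μ) X lam j) := by
  have hg : ∀ k, Measurable fun w : (Fin p → ℝ) × (Fin n → ℝ) =>
      (Xᵀ *ᵥ (X *ᵥ w.1 + w.2)) k := fun k => by
    unfold Matrix.mulVec dotProduct
    fun_prop
  have hsel : MeasurableSet {w : (Fin p → ℝ) × (Fin n → ℝ) |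
      elasticNet μ X lam (X *ᵥ w.1 + w.2) j ≠ 0} := by
    simp only [elasticNet_ne_zero_iff hρ hμ hX hlam]
    refine measurableSet_lt measurable_const (Measurable.abs ?_)
    exact (hg j).sub (measurable_const.mul (Finset.measurable_sum _ fun k _ =>
      (continuous_softThreshold lam).measurable.comp (hg k)))
  have hβ : MeasurableSet {w : (Fin p → ℝ) × (Fin n → ℝ) | w.1 j = 0} :=
    ((measurable_pi_apply j).comp measurable_fst) (measurableSet_singleton 0)
  have h : errorEvent (elasticNet μ) X lam j =
      ({w | elasticNet μ X lam (X *ᵥ w.1 + w.2) j ≠ 0} ∩ {w | w.1 j = 0}) ∪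
        ({w | elasticNet μ X lam (X *ᵥ w.1 + w.2) j ≠ 0}ᶜ ∩ {w | w.1 j = 0}ᶜ) := by
    ext w
    simp [errorEvent]
  rw [h]
  exact (hsel.inter hβ).union (hsel.compl.inter hβ.compl)

lemma col_dotProduct_col (hX : Xᵀ * X = blockGram ρ p) (j k : Fin p) :
    X.col j ⬝ᵥ X.col k = blockGram ρ p j k := by
  rw [← hX, Matrix.mul_apply]
  rfl

lemma measureReal_errorEvent_pair (hρ : |ρ| < 1) (hμ : 0 ≤ μ) (hX : Xᵀ * X = blockGram ρ p)
    (hlam : 0 ≤ lam) {ϑ r : ℝ} (hϑ : 0 < ϑ) (hτ : signalStrength r p ≠ 0) {j k : Fin p}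
    (hjk : k ∈ partners j) :
    ((signalLaw ϑ r p).prod (noiseLaw n)).real (errorEvent (elasticNet μ) X lam j) =
      pairError ρ (ρ / (1 + μ)) lam (sparsity ϑ p) (signalStrength r p) := by
  have hj := partners_eq_singleton hjk
  have hk := partners_eq_singleton (mem_partners_comm.1 hjk)
  have hne := (mem_partners.1 hjk).1
  have := isProbabilityMeasure_signalLaw hϑ r j.pos
  have := isProbabilityMeasure_coordLaw hϑ r j.pos
  set η := ρ / (1 + μ)
  set κ := √(1 - ρ ^ 2) with hκ
  have hκ0 : κ ≠ 0 := (sqrt_one_sub_sq_pos hρ).ne'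
  have hκ2 : κ ^ 2 = 1 - ρ ^ 2 := Real.sq_sqrt (one_sub_sq_pos hρ).le
  set u := X.col j with hu
  -- Gram–Schmidt on the two columns of the block; `u ⬝ᵥ z` and `v ⬝ᵥ z` are the whitened noise.
  set v := κ⁻¹ • (X.col k - ρ • X.col j) with hv
  have gjj : X.col j ⬝ᵥ X.col j = 1 := by rw [col_dotProduct_col hX]; simp [blockGram]
  have gkk : X.col k ⬝ᵥ X.col k = 1 := by rw [col_dotProduct_col hX]; simp [blockGram]
  have gjk : X.col j ⬝ᵥ X.col k = ρ := by
    rw [col_dotProduct_col hX]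
    simp [blockGram, hne.symm, (mem_partners.1 hjk).2.symm]
  have hvv : v ⬝ᵥ v = 1 := by
    simp only [hv, smul_dotProduct, dotProduct_smul, sub_dotProduct, dotProduct_sub, gjj, gkk, gjk,
      dotProduct_comm (X.col k) (X.col j), smul_eq_mul]
    field_simp
    rw [hκ2]
    ring
  have huv : u ⬝ᵥ v = 0 := by
    simp only [hu, hv, dotProduct_smul, dotProduct_sub, gjj, gjk, smul_eq_mul]
    ring
  set f : (Fin p → ℝ) → ℝ × ℝ := fun b => (b j, b k)
  set g : (Fin n → ℝ) → ℝ × ℝ := fun z => (u ⬝ᵥ z, v ⬝ᵥ z)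
  have hf : Measurable f := by fun_prop
  have hg : Measurable g := (measurable_dotProduct u).prodMk (measurable_dotProduct v)
  set S : Set ((ℝ × ℝ) × (ℝ × ℝ)) :=
    {w | (shiftedPoint (center ρ w.1.1 w.1.2) w.2 ∈ selected ρ η lam ∧ w.1.1 = 0) ∨
      (shiftedPoint (center ρ w.1.1 w.1.2) w.2 ∈ (selected ρ η lam)ᶜ ∧ w.1.1 ≠ 0)} with hS
  have hSmeas : MeasurableSet S := by
    have h1 : Measurable fun w : (ℝ × ℝ) × (ℝ × ℝ) =>
        shiftedPoint (center ρ w.1.1 w.1.2) w.2 := by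
      have h2 : Continuous fun w : (ℝ × ℝ) × (ℝ × ℝ) =>
          center ρ w.1.1 w.1.2 + Complex.equivRealProdCLM.symm w.2 :=
        ((continuous_center ρ).comp continuous_fst).add
          (Complex.equivRealProdCLM.symm.continuous.comp continuous_snd)
      exact h2.measurable
    have h3 := h1 (isOpen_selected ρ η lam).measurableSet
    have h4 : MeasurableSet {w : (ℝ × ℝ) × (ℝ × ℝ) | w.1.1 = 0} :=
      (measurable_fst.comp measurable_fst) (measurableSet_singleton 0)
    exact (h3.inter h4).union (h3.compl.inter h4.compl)
  have hpre : errorEvent (elasticNet μ) X lam j = Prod.map f g ⁻¹' S := by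
    ext ⟨b, z⟩
    have hstat : elasticNet μ X lam (X *ᵥ b + z) j ≠ 0 ↔
        shiftedPoint (center ρ (b j) (b k)) (g z) ∈ selected ρ η lam := by
      rw [elasticNet_ne_zero_iff hρ hμ hX hlam, hj, Finset.sum_singleton,
        transpose_mulVec_response hX, transpose_mulVec_response hX, hj, hk, Finset.sum_singleton,
        Finset.sum_singleton]
      have h1 : (shiftedPoint (center ρ (b j) (b k)) (g z)).re = b j + ρ * b k + X.col j ⬝ᵥ z :=
        rfl
      have h2 : sndCoord ρ (shiftedPoint (center ρ (b j) (b k)) (g z)) =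
          b k + ρ * b j + X.col k ⬝ᵥ z := by
        have h3 : sndCoord ρ (shiftedPoint (center ρ (b j) (b k)) (g z)) =
            sndCoord ρ (center ρ (b j) (b k)) + (ρ * (u ⬝ᵥ z) + κ * (v ⬝ᵥ z)) := by
          simp only [sndCoord, shiftedPoint, Complex.add_re, Complex.add_im, g, ← hκ]
          ring
        rw [h3, center, sndCoord_ofCoords hρ, hv, smul_dotProduct, sub_dotProduct, smul_dotProduct,
          smul_eq_mul, smul_eq_mul, mul_inv_cancel_left₀ hκ0, hu]
        ring
      rw [selected, Set.mem_ofPred_eq, h1, h2]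
    have hstat' : elasticNet μ X lam (X *ᵥ b + z) j = 0 ↔
        shiftedPoint (center ρ (b j) (b k)) (g z) ∈ (selected ρ η lam)ᶜ := by
      rw [Set.mem_compl_iff, ← hstat, not_not]
    simp only [errorEvent, Set.mem_ofPred_eq, Set.mem_preimage, hS, Prod.map_apply, f]
    rw [hstat, hstat']
  have hprob : ((signalLaw ϑ r p).prod (noiseLaw n)) (errorEvent (elasticNet μ) X lam j) =
      (((coordLaw ϑ r p).prod (coordLaw ϑ r p)).prod
        ((gaussianReal 0 1).prod (gaussianReal 0 1))) S := by
    rw [hpre, ← Measure.map_apply (hf.prodMap hg) hSmeas, ← Measure.map_prod_map _ _ hf hg,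
      map_signalLaw_pair hϑ r hne.symm, map_noiseLaw_pair gjj hvv huv]
  have hfp : ∀ b, ((gaussianReal 0 1).prod (gaussianReal 0 1)) (Prod.mk (0, b) ⁻¹' S) =
      ENNReal.ofReal (fpProb ρ η lam b) := fun b => by
    rw [fpProb, ofReal_measureReal]
    congr 1
    ext z
    simp [hS]
  have hfn : ∀ b, ((gaussianReal 0 1).prod (gaussianReal 0 1))
      (Prod.mk (signalStrength r p, b) ⁻¹' S) =
      ENNReal.ofReal (fnProb ρ η lam (signalStrength r p) b) := fun b => by
    rw [fnProb, ofReal_measureReal]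
    congr 1
    ext z
    simp [hS, hτ]
  have hε0 := (sparsity_pos j.pos ϑ).le
  have hε1 : 0 ≤ 1 - sparsity ϑ p := by linarith [sparsity_le_one j.pos hϑ]
  have e1 := fpProb_nonneg ρ η lam 0
  have e2 := fpProb_nonneg ρ η lam (signalStrength r p)
  have e3 := fnProb_nonneg ρ η lam (signalStrength r p) 0
  have e4 := fnProb_nonneg ρ η lam (signalStrength r p) (signalStrength r p)
  -- Integrating out the noise and then the two signals leaves the four configurations of the block.
  rw [Measure.real, hprob, Measure.prod_apply hSmeas,
    lintegral_prod _ (measurable_measure_prodMk_left hSmeas).aemeasurable, lintegral_coordLaw,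
    lintegral_coordLaw, lintegral_coordLaw, hfp, hfp, hfn, hfn]
  rw [← ENNReal.ofReal_mul hε0, ← ENNReal.ofReal_mul hε1, ← ENNReal.ofReal_mul hε0,
    ← ENNReal.ofReal_mul hε1, ← ENNReal.ofReal_add (by positivity) (by positivity),
    ← ENNReal.ofReal_add (by positivity) (by positivity), ← ENNReal.ofReal_mul hε0,
    ← ENNReal.ofReal_mul hε1, ← ENNReal.ofReal_add (by positivity) (by positivity),
    ENNReal.toReal_ofReal (by positivity), pairError]
  ring

lemma measureReal_errorEvent_single (hρ : |ρ| < 1) (hμ : 0 ≤ μ) (hX : Xᵀ * X = blockGram ρ p)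
    (hlam : 0 ≤ lam) {ϑ r : ℝ} (hϑ : 0 < ϑ) (hτ : signalStrength r p ≠ 0) {j : Fin p}
    (hj : partners j = ∅) :
    ((signalLaw ϑ r p).prod (noiseLaw n)).real (errorEvent (elasticNet μ) X lam j) =
      singleError lam (sparsity ϑ p) (signalStrength r p) := by
  have := isProbabilityMeasure_signalLaw hϑ r j.pos
  have := isProbabilityMeasure_coordLaw hϑ r j.pos
  set f : (Fin p → ℝ) → ℝ := fun b => b j
  set g : (Fin n → ℝ) → ℝ := fun z => X.col j ⬝ᵥ z
  have hf : Measurable f := measurable_pi_apply j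
  have hg : Measurable g := measurable_dotProduct _
  set S : Set (ℝ × ℝ) := {w | (lam < |w.1 + w.2| ∧ w.1 = 0) ∨ (|w.1 + w.2| ≤ lam ∧ w.1 ≠ 0)} with hS
  have hSmeas : MeasurableSet S := by
    have h3 : MeasurableSet {w : ℝ × ℝ | lam < |w.1 + w.2|} :=
      measurableSet_lt measurable_const (by fun_prop)
    have h4 : MeasurableSet {w : ℝ × ℝ | w.1 = 0} := measurable_fst (measurableSet_singleton 0)
    have h5 : MeasurableSet {w : ℝ × ℝ | |w.1 + w.2| ≤ lam} :=
      measurableSet_le (by fun_prop) measurable_const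
    exact (h3.inter h4).union (h5.inter h4.compl)
  have gjj : X.col j ⬝ᵥ X.col j = 1 := by rw [col_dotProduct_col hX]; simp [blockGram]
  have hpre : errorEvent (elasticNet μ) X lam j = Prod.map f g ⁻¹' S := by
    ext ⟨b, z⟩
    have hstat : elasticNet μ X lam (X *ᵥ b + z) j ≠ 0 ↔ lam < |b j + g z| := by
      rw [elasticNet_ne_zero_iff hρ hμ hX hlam, hj, Finset.sum_empty, mul_zero, sub_zero,
        transpose_mulVec_response hX, hj, Finset.sum_empty, mul_zero, add_zero]
    have hstat' : elasticNet μ X lam (X *ᵥ b + z) j = 0 ↔ |b j + g z| ≤ lam := by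
      rw [← not_lt, ← hstat, not_not]
    simp only [errorEvent, Set.mem_ofPred_eq, Set.mem_preimage, hS, Prod.map_apply, f]
    rw [hstat, hstat']
  have hprob : ((signalLaw ϑ r p).prod (noiseLaw n)) (errorEvent (elasticNet μ) X lam j) =
      ((coordLaw ϑ r p).prod (gaussianReal 0 1)) S := by
    rw [hpre, ← Measure.map_apply (hf.prodMap hg) hSmeas, ← Measure.map_prod_map _ _ hf hg,
      map_signalLaw_apply hϑ r, map_noiseLaw_dotProduct gjj]
  have hfp : (gaussianReal 0 1) (Prod.mk 0 ⁻¹' S) =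
      ENNReal.ofReal ((gaussianReal 0 1).real {x | lam < |x|}) := by
    rw [ofReal_measureReal]
    congr 1
    ext z
    simp [hS]
  have hfn : (gaussianReal 0 1) (Prod.mk (signalStrength r p) ⁻¹' S) =
      ENNReal.ofReal ((gaussianReal 0 1).real {x | |signalStrength r p + x| ≤ lam}) := by
    rw [ofReal_measureReal]
    congr 1
    ext z
    simp [hS, hτ]
  have hε0 := (sparsity_pos j.pos ϑ).le
  have hε1 : 0 ≤ 1 - sparsity ϑ p := by linarith [sparsity_le_one j.pos hϑ]
  rw [Measure.real, hprob, Measure.prod_apply hSmeas, lintegral_coordLaw, hfp, hfn,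
    ← ENNReal.ofReal_mul hε0, ← ENNReal.ofReal_mul hε1,
    ← ENNReal.ofReal_add (by positivity) (by positivity), ENNReal.toReal_ofReal (by positivity),
    singleError, add_comm]

lemma pairError_nonneg (ρ η lam τ : ℝ) {ε : ℝ} (h0 : 0 ≤ ε) (h1 : ε ≤ 1) :
    0 ≤ pairError ρ η lam ε τ := by
  have := sub_nonneg.2 h1
  have e1 := fpProb_nonneg ρ η lam 0
  have e2 := fpProb_nonneg ρ η lam τ
  have e3 := fnProb_nonneg ρ η lam τ 0
  have e4 := fnProb_nonneg ρ η lam τ τ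
  unfold pairError
  positivity

lemma singleError_nonneg (lam τ : ℝ) {ε : ℝ} (h0 : 0 ≤ ε) (h1 : ε ≤ 1) :
    0 ≤ singleError lam ε τ := by
  have := sub_nonneg.2 h1
  unfold singleError
  positivity

/-- The expected Hamming error, up to the contribution of the last index. -/
lemma expectedHamming_elasticNet_bounds (hρ : |ρ| < 1) (hμ : 0 ≤ μ)
    (hX : Xᵀ * X = blockGram ρ p) (hlam : 0 ≤ lam) {ϑ r : ℝ} (hϑ : 0 < ϑ)
    (hτ : signalStrength r p ≠ 0) (hp : 0 < p) :
    ((p : ℝ) - 1) * pairError ρ (ρ / (1 + μ)) lam (sparsity ϑ p) (signalStrength r p) ≤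
        expectedHamming (elasticNet μ) X lam ϑ r ∧
      expectedHamming (elasticNet μ) X lam ϑ r ≤
        p * pairError ρ (ρ / (1 + μ)) lam (sparsity ϑ p) (signalStrength r p) +
          singleError lam (sparsity ϑ p) (signalStrength r p) := by
  obtain ⟨m, rfl⟩ : ∃ m, p = m + 1 := ⟨p - 1, by omega⟩
  have hε0 := (sparsity_pos hp ϑ).le
  have hε1 := sparsity_le_one hp hϑ
  have hpe := pairError_nonneg ρ (ρ / (1 + μ)) lam (signalStrength r (m + 1)) hε0 hε1
  have hse := singleError_nonneg lam (signalStrength r (m + 1)) hε0 hε1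
  rw [expectedHamming_eq_sum _ X lam hϑ r hp
    (measurableSet_errorEvent_elasticNet hρ hμ hX hlam), Fin.sum_univ_castSucc]
  have h1 : ∀ i : Fin m, ((signalLaw ϑ r (m + 1)).prod (noiseLaw n)).real
      (errorEvent (elasticNet μ) X lam i.castSucc) =
      pairError ρ (ρ / (1 + μ)) lam (sparsity ϑ (m + 1)) (signalStrength r (m + 1)) := fun i => by
    -- Every index except possibly the last is in a pair, whatever the parity, so only the last one
    -- needs a case distinction.
    obtain ⟨k, hk⟩ := exists_partner i.castSucc (by simp)
    exact measureReal_errorEvent_pair hρ hμ hX hlam hϑ hτ hk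
  rw [Finset.sum_congr rfl fun i _ => h1 i, Finset.sum_const, Finset.card_univ, Fintype.card_fin,
    nsmul_eq_mul]
  push_cast
  have h2 : 0 ≤ ((signalLaw ϑ r (m + 1)).prod (noiseLaw n)).real
    (errorEvent (elasticNet μ) X lam (Fin.last m)) := measureReal_nonneg
  refine ⟨by linarith, ?_⟩
  rcases partners_eq_empty_or (Fin.last m) with h | ⟨k, -, h, -⟩
  · rw [measureReal_errorEvent_single hρ hμ hX hlam hϑ hτ h]
    linarith
  · rw [measureReal_errorEvent_pair hρ hμ hX hlam hϑ hτ (h ▸ Finset.mem_singleton_self k)]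
    linarith

end Net

/-! ### The phase curves -/

lemma isHammingExponent_elasticNet {ρ μ : ℝ} (hρ : |ρ| < 1) (hμ : 0 ≤ μ) :
    IsHammingExponent ρ (elasticNet μ) (blockExponent ρ (ρ / (1 + μ))) := by
  intro n X hX q ϑ r hq hϑ hϑ1 hr
  have hU := (upperRate_pairError ρ (ρ / (1 + μ)) q hϑ r).rpow_mul 1
  have hL := ((lowerRate_pairError hρ (ρ / (1 + μ)) r hq hϑ).rpow_mul 1).const_mul
    (show (0 : ℝ) < 1 / 2 by norm_num)
  have hS := (upperRate_singleError hρ (ρ / (1 + μ)) ϑ r hq).mono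
    (show -blockExponent ρ (ρ / (1 + μ)) q ϑ r ≤ 1 + -blockExponent ρ (ρ / (1 + μ)) q ϑ r by
      linarith)
  have hb := fun (p : ℕ) (hp : 1 < p) => expectedHamming_elasticNet_bounds (lam := tuning q p) hρ hμ
    (hX p) (Real.sqrt_nonneg _) (r := r) hϑ
    (by rw [signalStrength_eq]; exact (mul_pos (logScale_pos hp) (Real.sqrt_pos.2 hr)).ne')
    (zero_lt_one.trans hp)
  rw [sub_eq_add_neg]
  refine hasPolyRate_of_rates ((hU.add hS).mono_left ?_) (hL.mono_left ?_)
  · filter_upwards [eventually_gt_atTop 1] with p hp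
    rw [Real.rpow_one]
    exact (hb p hp).2
  · filter_upwards [eventually_gt_atTop 1] with p hp
    rw [Real.rpow_one, ← mul_assoc]
    refine le_trans (mul_le_mul_of_nonneg_right ?_ ?_) (hb p hp).1
    -- The factor `1/2` in `hL` comes from `p / 2 ≤ p - 1`.
    · have : (2 : ℝ) ≤ p := by exact_mod_cast hp
      linarith
    · have hp0 := zero_lt_one.trans hp
      exact pairError_nonneg _ _ _ _ (sparsity_pos hp0 ϑ).le (sparsity_le_one hp0 hϑ)

lemma hasPhaseCurves_elasticNet {ρ μ : ℝ} (hρ : |ρ| < 1) (hμ : 0 ≤ μ) :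
    HasPhaseCurves ρ (elasticNet μ) (fun ϑ => (ϑ : EReal))
      (upperCurveFormula ρ (ρ / (1 + μ))) := by
  have hη : |ρ / (1 + μ)| ≤ |ρ| := by
    rw [abs_div, abs_of_pos (by positivity : 0 < 1 + μ)]
    exact div_le_self (abs_nonneg ρ) (by linarith)
  have hρη : 0 ≤ ρ * (ρ / (1 + μ)) := by
    rw [← mul_div_assoc]
    exact div_nonneg (mul_self_nonneg ρ) (by positivity)
  exact ⟨blockExponent ρ (ρ / (1 + μ)), idealExponent ρ (ρ / (1 + μ)),
    isHammingExponent_elasticNet hρ hμ,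
    fun ϑ r hϑ _ _ => isGreatest_idealExponent hρ _ hϑ r,
    fun ϑ hϑ hϑ1 => ⟨lowerPhaseCurve_idealExponent hρ hη hρη hϑ,
      upperPhaseCurve_idealExponent hρ hη hρη hϑ hϑ1⟩⟩

lemma lasso_eq_elasticNet : @lasso = @elasticNet 0 := by
  funext n p X lam y
  rw [lasso, elasticNet, lassoObjective_eq]

end RareWeak
end

theorem mainTheorem1 (ρ μ : ℝ) (hρ : |ρ| < 1) (hμ : 0 ≤ μ) :
    -- the Elastic net and Lasso estimators are well defined
    (∀ (n p : ℕ) (X : Matrix (Fin n) (Fin p) ℝ), Xᵀ * X = RareWeak.blockGram ρ p →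
      ∀ (lam : ℝ) (y : Fin n → ℝ), 0 ≤ lam →
        (∃! b, IsMinOn (RareWeak.elasticNetObjective μ X lam y) Set.univ b) ∧
          ∃! b, IsMinOn (RareWeak.lassoObjective X lam y) Set.univ b) ∧
    -- the phase curves of Elastic net, with `η = ρ / (1 + μ)`
    RareWeak.HasPhaseCurves ρ (RareWeak.elasticNet μ)
      (fun ϑ => (ϑ : EReal)) (RareWeak.upperCurveFormula ρ (ρ / (1 + μ))) ∧
    -- the phase curves of Lasso, with `η = ρ`
    RareWeak.HasPhaseCurves ρ RareWeak.lasso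
      (fun ϑ => (ϑ : EReal)) (RareWeak.upperCurveFormula ρ ρ) := by
  refine ⟨fun n p X hX lam y hlam => ⟨?_, ?_⟩, RareWeak.hasPhaseCurves_elasticNet hρ hμ, ?_⟩
  · exact RareWeak.existsUnique_isMinOn_elasticNetObjective hρ hμ hX hlam y
  · rw [RareWeak.lassoObjective_eq]
    exact RareWeak.existsUnique_isMinOn_elasticNetObjective hρ le_rfl hX hlam y
  · have h := RareWeak.hasPhaseCurves_elasticNet hρ le_rfl
    rw [add_zero, div_one] at h
    rwa [RareWeak.lasso_eq_elasticNet]
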